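/- Let $k$ be a field, $A$ an associative unital $k$-algebra, $M$ an $A$-bimodule over $k$, and $0 \to M \xrightarrow{i} \widetilde A \xrightarrow{p} A \to 0$ a square-zero extension (so $p$ is a map of unital $k$-algebras and $x\,i(m) = i(p(x)m)$, $i(m)\,x = i(m\,p(x))$). *Notation.* Let $\Lambda$ be the cyclic category: its objects $[n]$, $n \ge 1$, are circles with a set $V([n])$ of $n$ marked points, and its morphisms are homotopy classes of non-decreasing degree one maps preserving marked points. For an associative unital algebra $B$, the cyclic vector space $B_\# \in \operatorname{Fun}(\Lambda,k)$ is $B_\#([n]) = B^{\otimes V([n])}$, with $f:[n'] \to [n]$ acting by $\bigotimes_{v \in V([n])} m_{f^{-1}(v)}$, where $m_S : B^{\otimes S}\to B$ is the ordered multiplication. For $E \in \operatorname{Fun}(\Lambda,k)$ put $HC_\bullet(E) = H_\bullet(\Lambda,E)$, and let $HP_\bullet(E)$ be the homology of the derived inverse limit of the standard complexes computing $HC_\bullet(E)$ along the periodicity map $u$ of degree $-2$ given by the action of the canonical generator of $H^2(\Lambda,k)$; write $HP_\bullet(A) = HP_\bullet(A_\#)$. A cyclic $A$-bimodule structure on $M$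 is a section $M_\#$ of the cofibration over $\Lambda$ with fibre the category of $A^{\otimes V([n])}$-bimodules over $[n]$ and with transition functors $f_! = \bigotimes_v m_{f^{-1}(v)!}$, which is cocartesian (all the maps $f_!M_\#([n']) \to M_\#([n])$ are isomorphisms), together with an isomorphism $M_\#([1]) \cong M$ of $A$-bimodules. Forgetting the bimodule structures, $M_\#$ is a cyclic vector space; $HP_\bullet(A,M) = HP_\bullet(M_\#)$. Let $j : \Delta^{opp} \to \Lambda$ be the projection from the category of pairs $\langle [n], v \in V([n])\rangle$, and let $M^\Delta_\#$ be the simplicial vector space with $M^\Delta_\#(\langle [n],v\rangle) = M \otimes A^{\otimes (V([n]) \setminus \{v\})}$ computing the Hochschild homology of $A$ with coefficients in $M$. There is a canonical map $\tau_\# : j_!M^\Delta_\# \to M_\#$, adjoint to the map $M^\Delta_\# \to j^*M_\#$ that sends $m \otimes \bigotimes_w a_w$ over $\langle [n],v\rangle$ to $(\bigotimes_w a_w) \cdot M_\#(v)(m)$, with $v : [1] \to [n]$. Let $F^2\widetilde A_\# \subset \widetilde A_\#$ be spanned by the pure tensors with at least two factors in $M$, and put $\overline{A_\#} = \widetilde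 A_\#/F^2\widetilde A_\#$. The kernel of $\overline{A_\#} \to A_\#$ is $j_!M^\Delta_\#$, and $\widehat{A_\#}$ is the pushout of $\overline{A_\#}$ along $\tau_\#$. **Proposition.** Let $\widetilde A$ be a square-zero extension of $A$ by $M$, and let $M$ be equipped with a structure of a cyclic $A$-bimodule. Then the sequence $0 \to M_\# \to \widehat{A_\#} \to A_\# \to 0$ of cyclic vector spaces is exact, it induces a short exact sequence of the complexes computing periodic cyclic homology, and the resulting long exact sequence $$\cdots \to HP_\bullet(A,M) \to HP_\bullet(\widehat{A_\#}) \to HP_\bullet(A) \to \cdots$$ has a canonical splitting. Precisely: all its connecting homomorphisms vanish, and for every $i \in \mathbb Z$ there is a unique linear map $s : HP_i(A) \to HP_i(\widehat{A_\#})$ whose composition with the natural map $HP_i(\overline{A_\#}) \to HP_i(A)$ is the natural map $HP_i(\overline{A_\#}) \to HP_i(\widehat{A_\#})$, and this $s$ is a section of $HP_i(\widehat{A_\#}) \to HP_i(A)$. -/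

import Mathlib

open CategoryTheory
open scoped TensorProduct DirectSum

set_option linter.unusedSectionVars false

universe u

namespace CyclicHomology

/-! ### The cyclic category -/

/-- A non-decreasing map `f : ℤ → ℤ` with `f (i + m) = f i + n`: the lift to universal covers of a
degree one, non-decreasing map from the circle with `m` marked points to the circle with `n` marked
points, restricted to the (lifted) marked points. -/
@[ext]
structure CycLift (m n : ℕ) where
  toFun : ℤ → ℤ
  mono : Monotone toFun
  per : ∀ i, toFun (i + m) = toFun i + n

namespace CycLift

instance (m n : ℕ) : CoeFun (CycLift m n) (fun _ => ℤ → ℤ) := ⟨toFun⟩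

def id (n : ℕ) : CycLift n n := ⟨fun i => i, fun _ _ h => h, fun _ => rfl⟩

def comp {l m n : ℕ} (f : CycLift l m) (g : CycLift m n) : CycLift l n :=
  ⟨fun i => g (f i), fun _ _ h => g.mono (f.mono h), fun i => by rw [f.per, g.per]⟩

/-- The lift differing from `f` by `c` full turns of the target circle. -/
def turn {m n : ℕ} (f : CycLift m n) (c : ℤ) : CycLift m n :=
  ⟨fun i => f i + c * n, fun _ _ h => by simpa using f.mono h, fun i => by rw [f.per]; ring⟩

/-- Two lifts define the same homotopy class of maps of circles iff they differ by full turns. -/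
instance setoid (m n : ℕ) : Setoid (CycLift m n) where
  r f g := ∃ c : ℤ, g = f.turn c
  iseqv :=
    { refl := fun f => ⟨0, by ext; simp [turn]⟩
      symm := by
        rintro f _ ⟨c, rfl⟩
        exact ⟨-c, by ext; simp [turn]⟩
      trans := by
        rintro f _ _ ⟨c, rfl⟩ ⟨d, rfl⟩
        exact ⟨c + d, by ext; simp [turn]; ring⟩ }

/-- The representative with `0 ≤ f 0 < n`. -/
def normalize {m n : ℕ} (f : CycLift m n) : CycLift m n := f.turn (-(f 0 / n))

theorem per_mul {m n : ℕ} (f : CycLift m n) (i c : ℤ) : f (i + c * m) = f i + c * n := by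
  induction c with
  | zero => simp
  | succ c ih => rw [add_mul, ← add_assoc, one_mul, f.per, ih]; ring
  | pred c ih =>
    have := f.per (i + (-c - 1) * m)
    rw [show i + (-c - 1) * (m : ℤ) + m = i + -c * m by ring, ih] at this
    linarith

end CycLift

/-- Objects of the cyclic category `Λ`: a circle with `n ≥ 1` marked points. -/
structure Cyc where
  n : ℕ
  pos : 0 < n

instance (X : Cyc) : NeZero X.n := ⟨X.pos.ne'⟩

/-- The cyclic category `Λ`. -/
instance : Category Cyc where
  Hom X Y := Quotient (CycLift.setoid X.n Y.n)
  id X := Quotient.mk _ (CycLift.id X.n)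
  comp f g := Quotient.map₂ CycLift.comp (by
    rintro f _ ⟨c, rfl⟩ g _ ⟨d, rfl⟩
    refine ⟨c + d, ?_⟩
    ext i
    simp only [CycLift.comp, CycLift.turn, CycLift.per_mul]
    ring) f g
  id_comp f := by induction f using Quotient.inductionOn; rfl
  comp_id f := by induction f using Quotient.inductionOn; rfl
  assoc f g h := by
    induction f using Quotient.inductionOn
    induction g using Quotient.inductionOn
    induction h using Quotient.inductionOn
    rfl

namespace Cyc

/-- The morphism of `Λ` represented by a lift. -/
def mkHom {X Y : Cyc} (f : CycLift X.n Y.n) : X ⟶ Y := Quotient.mk _ f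

/-- The unique lift `f` of a morphism of `Λ` with `0 ≤ f 0 < n`. -/
def lift {X Y : Cyc} (f : X ⟶ Y) : CycLift X.n Y.n :=
  Quotient.lift CycLift.normalize (by
    rintro f _ ⟨c, rfl⟩
    ext i
    have : (Y.n : ℤ) ≠ 0 := by exact_mod_cast Y.pos.ne'
    simp only [CycLift.normalize, CycLift.turn, Int.add_mul_ediv_right _ _ this]
    ring) f

theorem mkHom_lift {X Y : Cyc} (f : X ⟶ Y) : mkHom (lift f) = f := by
  induction f using Quotient.inductionOn with
  | _ f => exact (Quotient.sound (s := CycLift.setoid _ _) ⟨_, rfl⟩ : _ = Quotient.mk _ f.normalize).symm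

theorem lift_mkHom {X Y : Cyc} (f : CycLift X.n Y.n) : lift (mkHom f) = f.normalize := rfl

theorem mkHom_turn {X Y : Cyc} (f : CycLift X.n Y.n) (c : ℤ) : mkHom (f.turn c) = mkHom f :=
  (Quotient.sound (s := CycLift.setoid _ _) ⟨c, rfl⟩ : _ = Quotient.mk _ (f.turn c)).symm

theorem mkHom_comp {X Y Z : Cyc} (f : CycLift X.n Y.n) (g : CycLift Y.n Z.n) :
    mkHom f ≫ mkHom g = (mkHom (f.comp g) : X ⟶ Z) := rfl

theorem mkHom_id (X : Cyc) : mkHom (CycLift.id X.n) = 𝟙 X := rfl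

theorem lift_id (X : Cyc) : lift (𝟙 X) = CycLift.id X.n := by
  ext i
  simp [← mkHom_id, lift_mkHom, CycLift.normalize, CycLift.turn, CycLift.id]

theorem lift_comp {X Y Z : Cyc} (f : X ⟶ Y) (g : Y ⟶ Z) :
    lift (f ≫ g) = ((lift f).comp (lift g)).normalize := by
  conv_lhs => rw [← mkHom_lift f, ← mkHom_lift g, mkHom_comp, lift_mkHom]

theorem lift_zero_nonneg {X Y : Cyc} (f : X ⟶ Y) : 0 ≤ lift f 0 := by
  rw [← mkHom_lift f, lift_mkHom]
  have := Int.emod_nonneg (lift f 0) (b := Y.n) (by exact_mod_cast Y.pos.ne')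
  have h2 := Int.emod_add_mul_ediv (lift f 0) Y.n
  simp only [CycLift.normalize, CycLift.turn]; linarith

theorem lift_zero_lt {X Y : Cyc} (f : X ⟶ Y) : lift f 0 < Y.n := by
  rw [← mkHom_lift f, lift_mkHom]
  have := Int.emod_lt_of_pos (lift f 0) (b := Y.n) (by exact_mod_cast Y.pos)
  have h2 := Int.emod_add_mul_ediv (lift f 0) Y.n
  simp only [CycLift.normalize, CycLift.turn]; linarith

/-- The map `V(f)` on marked points induced by a morphism `f` of `Λ`. -/
def pt {X Y : Cyc} (f : X ⟶ Y) (v : ZMod X.n) : ZMod Y.n := ((lift f (v.val : ℤ) : ℤ) : ZMod Y.n)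

theorem pt_intCast {X Y : Cyc} (f : X ⟶ Y) (i : ℤ) :
    pt f (i : ZMod X.n) = ((lift f i : ℤ) : ZMod Y.n) := by
  have h : ∃ c : ℤ, (((i : ZMod X.n).val : ℕ) : ℤ) = i + c * X.n := by
    refine ⟨-(i / X.n), ?_⟩
    rw [ZMod.val_intCast]
    have := Int.emod_add_mul_ediv i X.n
    linarith
  obtain ⟨c, hc⟩ := h
  simp [pt, hc, CycLift.per_mul]

theorem exists_int {X : Cyc} (v : ZMod X.n) : ∃ i : ℤ, (i : ZMod X.n) = v :=
  ⟨v.val, by simp⟩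

theorem pt_mkHom {X Y : Cyc} (f : CycLift X.n Y.n) (i : ℤ) :
    pt (mkHom f : X ⟶ Y) (i : ZMod X.n) = ((f i : ℤ) : ZMod Y.n) := by
  simp [pt_intCast, lift_mkHom, CycLift.normalize, CycLift.turn]

theorem pt_id (X : Cyc) (v : ZMod X.n) : pt (𝟙 X) v = v := by
  obtain ⟨i, rfl⟩ := exists_int v
  rw [← mkHom_id, pt_mkHom]; rfl

theorem pt_comp {X Y Z : Cyc} (f : X ⟶ Y) (g : Y ⟶ Z) (v : ZMod X.n) :
    pt (f ≫ g) v = pt g (pt f v) := by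
  obtain ⟨i, rfl⟩ := exists_int v
  rw [← mkHom_lift f, ← mkHom_lift g, mkHom_comp]
  simp only [pt_mkHom]; rfl

/-- The object `[1]`. -/
def one : Cyc := ⟨1, one_pos⟩

/-- The morphism `[1] ⟶ [n]` corresponding to a marked point `v`. -/
def point {X : Cyc} (v : ZMod X.n) : one ⟶ X :=
  mkHom ⟨fun i => v.val + i * X.n, fun _ _ h => by
    simpa using mul_le_mul_of_nonneg_right h (Int.natCast_nonneg X.n), fun i => by
    simp [one]; ring⟩

theorem point_comp {X Y : Cyc} (v : ZMod X.n) (f : X ⟶ Y) : point v ≫ f = point (pt f v) := by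
  have h : ∃ c : ℤ, lift f (v.val : ℤ) = (((pt f v).val : ℕ) : ℤ) + c * Y.n := by
    refine ⟨lift f (v.val : ℤ) / Y.n, ?_⟩
    rw [pt, ZMod.val_intCast]
    have := Int.emod_add_mul_ediv (lift f (v.val : ℤ)) Y.n
    linarith
  obtain ⟨c, hc⟩ := h
  rw [← mkHom_lift f, point, mkHom_comp, mkHom_lift, point, ← mkHom_turn _ (-c)]
  congr 1
  ext i
  simp only [CycLift.comp, CycLift.per_mul, CycLift.turn, hc]
  ring

end Cyc

/-- Objects `⟨[n], v⟩` of the category of marked circles with a distinguished marked point. -/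
structure PtCyc where
  base : Cyc
  v : ZMod base.n

/-- The discrete cofibration over `Λ` associated to `V` (equivalent to `Δᵒᵖ`). -/
instance : Category PtCyc where
  Hom X Y := { f : X.base ⟶ Y.base // Cyc.pt f X.v = Y.v }
  id X := ⟨𝟙 _, Cyc.pt_id _ _⟩
  comp f g := ⟨f.1 ≫ g.1, by rw [Cyc.pt_comp, f.2, g.2]⟩

namespace PtCyc

/-- A morphism of `Λ` preserving the distinguished points. -/
def homMk {P Q : PtCyc} (f : P.base ⟶ Q.base) (h : Cyc.pt f P.v = Q.v) : P ⟶ Q := ⟨f, h⟩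

end PtCyc

/-- The projection `j`. -/
def PtCyc.j : PtCyc ⥤ Cyc where
  obj X := X.base
  map f := f.1

/-! ### Fibres and ordered products -/

namespace CycLift

variable {m n : ℕ}

/-- The left end of the fibre: `f ⁻¹ {w}` is the interval `[f.lo w, f.lo (w + 1))` of `ℤ`. -/
noncomputable def lo (f : CycLift m n) (w : ℤ) : ℤ := sInf {i : ℤ | w ≤ f i}

variable [NeZero m] [NeZero n]

theorem lo_le_iff (f : CycLift m n) (w i : ℤ) : f.lo w ≤ i ↔ w ≤ f i := by
  have hn : (1 : ℤ) ≤ n := by exact_mod_cast NeZero.one_le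
  have hm : (1 : ℤ) ≤ m := by exact_mod_cast NeZero.one_le
  have hne : {i : ℤ | w ≤ f i}.Nonempty := by
    refine ⟨0 + |w - f 0| * m, ?_⟩
    simp only [Set.mem_ofPred_eq, per_mul]
    nlinarith [le_abs_self (w - f 0), abs_nonneg (w - f 0)]
  have hbd : BddBelow {i : ℤ | w ≤ f i} := by
    refine ⟨0 + -(|w - f 0| + 1) * m, fun i hi => ?_⟩
    by_contra h
    have h2 := f.mono (not_le.mp h).le
    rw [per_mul] at h2
    have h3 : w ≤ f i := hi
    nlinarith [neg_abs_le (w - f 0), abs_nonneg (w - f 0)]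
  refine ⟨fun h => ?_, fun h => csInf_le hbd h⟩
  have h1 : w ≤ f (f.lo w) := Int.csInf_mem hne hbd
  exact h1.trans (f.mono h)

theorem lo_mono (f : CycLift m n) {w w' : ℤ} (h : w ≤ w') : f.lo w ≤ f.lo w' :=
  (f.lo_le_iff _ _).2 (h.trans ((f.lo_le_iff _ _).1 le_rfl))

theorem mem_fibre (f : CycLift m n) (w i : ℤ) : f.lo w ≤ i ∧ i < f.lo (w + 1) ↔ f i = w := by
  rw [lo_le_iff, ← not_le, lo_le_iff]; omega

theorem lo_eq (f : CycLift m n) {w x : ℤ} (h : ∀ i, w ≤ f i ↔ x ≤ i) : f.lo w = x :=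
  le_antisymm ((f.lo_le_iff _ _).2 ((h _).2 le_rfl)) ((h _).1 ((f.lo_le_iff _ _).1 le_rfl))

theorem lo_id (w : ℤ) : (CycLift.id n).lo w = w := lo_eq _ fun _ => Iff.rfl

theorem lo_comp {l : ℕ} [NeZero l] (f : CycLift l m) (g : CycLift m n) (w : ℤ) :
    (f.comp g).lo w = f.lo (g.lo w) :=
  lo_eq _ fun i => by rw [f.lo_le_iff, g.lo_le_iff]; rfl

theorem lo_turn (f : CycLift m n) (c w : ℤ) : (f.turn c).lo (w + c * n) = f.lo w :=
  lo_eq _ fun i => by rw [f.lo_le_iff]; simp [turn]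

theorem lo_per (f : CycLift m n) (w c : ℤ) : f.lo (w + c * n) = f.lo w + c * m :=
  lo_eq _ fun i => by
    rw [show f.lo w + c * m ≤ i ↔ f.lo w ≤ i - c * m from le_sub_iff_add_le.symm, lo_le_iff]
    have := f.per_mul (i - c * m) c
    rw [sub_add_cancel] at this
    rw [this]; constructor <;> intro <;> linarith

theorem eq_of_fibre (f : CycLift m n) {i j : ℤ} (h : (i : ZMod m) = (j : ZMod m))
    (hf : f i = f j) : i = j := by
  rw [ZMod.intCast_eq_intCast_iff_dvd_sub] at h
  obtain ⟨c, hc⟩ := h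
  have hj : j = i + c * m := by linarith
  rw [hj, per_mul] at hf
  have hn : (n : ℤ) ≠ 0 := by exact_mod_cast NeZero.ne n
  have : c = 0 := by
    have : c * (n : ℤ) = 0 := by linarith
    exact (mul_eq_zero.1 this).resolve_right hn
  simp [hj, this]

end CycLift

/-- The ordered product `c x * c (x + 1) * ⋯ * c (y - 1)`. -/
def iprod {B : Type*} [Monoid B] (c : ℤ → B) (x y : ℤ) : B :=
  ((List.range (y - x).toNat).map fun j : ℕ => c (x + j)).prod

section iprod

variable {B : Type*} [Monoid B]

theorem iprod_self (c : ℤ → B) (x : ℤ) : iprod c x x = 1 := by simp [iprod]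

theorem iprod_succ (c : ℤ → B) (x : ℤ) : iprod c x (x + 1) = c x := by simp [iprod]

theorem iprod_mul (c : ℤ → B) {x y z : ℤ} (h : x ≤ y) (h' : y ≤ z) :
    iprod c x y * iprod c y z = iprod c x z := by
  obtain ⟨p, rfl⟩ := Int.le.dest h
  obtain ⟨q, rfl⟩ := Int.le.dest h'
  have h1 : (x + p - x).toNat = p := by omega
  have h2 : (x + p + q - (x + p)).toNat = q := by omega
  have h3 : (x + p + q - x).toNat = p + q := by omega
  simp only [iprod, h1, h2, h3, List.range_add, List.map_append, List.prod_append, List.map_map]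
  congr 3
  funext j
  simp [add_assoc]

theorem iprod_congr {c c' : ℤ → B} {x y : ℤ} (h : ∀ i, x ≤ i → i < y → c i = c' i) :
    iprod c x y = iprod c' x y := by
  unfold iprod
  congr 1
  refine List.map_congr_left fun j hj => h _ (by omega) ?_
  rw [List.mem_range] at hj
  omega

theorem iprod_shift (c : ℤ → B) (x y d : ℤ) :
    iprod (fun i => c (i + d)) x y = iprod c (x + d) (y + d) := by
  simp only [iprod, add_sub_add_right_eq_sub]
  congr 2
  funext j
  congr 1
  ring

theorem map_iprod {C : Type*} [Monoid C] (φ : B →* C) (c : ℤ → B) (x y : ℤ) :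
    φ (iprod c x y) = iprod (fun i => φ (c i)) x y := by
  simp [iprod, map_list_prod, Function.comp_def]

theorem iprod_split (c : ℤ → B) {x y i : ℤ} (h : x ≤ i) (h' : i < y) :
    iprod c x y = iprod c x i * c i * iprod c (i + 1) y := by
  rw [← iprod_succ c i, iprod_mul c h (by omega), iprod_mul c (by omega) (by omega)]

end iprod

namespace Cyc

variable {X Y Z : Cyc} {B : Type*} [Monoid B]

/-- A family indexed by the marked points, seen as a periodic family. -/
def per {n : ℕ} (b : ZMod n → B) : ℤ → B := fun i => b (i : ZMod n)

/-- `(push f b) w` is the product of the family `b` over the linearly ordered set `f ⁻¹ {w}`. -/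
noncomputable def push (f : X ⟶ Y) (b : ZMod X.n → B) : ZMod Y.n → B := fun w =>
  iprod (per b) ((lift f).lo (w.val : ℤ)) ((lift f).lo ((w.val : ℤ) + 1))

theorem iprod_per (b : ZMod X.n → B) (x y c : ℤ) :
    iprod (per b) (x + c * X.n) (y + c * X.n) = iprod (per b) x y := by
  rw [← iprod_shift]
  congr 1
  funext i
  simp [per]

theorem push_intCast (f : X ⟶ Y) (b : ZMod X.n → B) (w : ℤ) :
    push f b (w : ZMod Y.n) = iprod (per b) ((lift f).lo w) ((lift f).lo (w + 1)) := by
  have h : ∃ c : ℤ, (((w : ZMod Y.n).val : ℕ) : ℤ) = w + c * Y.n := by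
    refine ⟨-(w / Y.n), ?_⟩
    rw [ZMod.val_intCast]
    have := Int.emod_add_mul_ediv w Y.n
    linarith
  obtain ⟨c, hc⟩ := h
  rw [push, hc, add_right_comm, CycLift.lo_per, CycLift.lo_per, iprod_per]

theorem push_mkHom (f : CycLift X.n Y.n) (b : ZMod X.n → B) (w : ℤ) :
    push (mkHom f : X ⟶ Y) b (w : ZMod Y.n) = iprod (per b) (f.lo w) (f.lo (w + 1)) := by
  have : ((w + -(f 0 / Y.n) * Y.n : ℤ) : ZMod Y.n) = (w : ZMod Y.n) := by simp
  rw [← this, push_intCast, lift_mkHom, CycLift.normalize, add_right_comm, CycLift.lo_turn,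
    CycLift.lo_turn]

theorem iprod_push (f : X ⟶ Y) (b : ZMod X.n → B) {x y : ℤ} (h : x ≤ y) :
    iprod (per (push f b)) x y = iprod (per b) ((lift f).lo x) ((lift f).lo y) := by
  obtain ⟨p, rfl⟩ := Int.le.dest h
  induction p with
  | zero => simp [iprod_self]
  | succ p ih =>
    rw [← iprod_mul (per (push f b)) (y := x + p) (by omega) (by omega), ih (by omega)]
    have : x + ((p + 1 : ℕ) : ℤ) = x + p + 1 := by push_cast; ring
    rw [this, iprod_succ, per, push_intCast, iprod_mul _ (CycLift.lo_mono _ (by omega))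
      (CycLift.lo_mono _ (by omega))]

theorem push_id (b : ZMod X.n → B) : push (𝟙 X) b = b := by
  funext w
  obtain ⟨i, rfl⟩ := exists_int w
  rw [push_intCast, lift_id, CycLift.lo_id, CycLift.lo_id, iprod_succ, per]

theorem push_comp (f : X ⟶ Y) (g : Y ⟶ Z) (b : ZMod X.n → B) :
    push (f ≫ g) b = push g (push f b) := by
  funext w
  obtain ⟨i, rfl⟩ := exists_int w
  rw [push_intCast g, iprod_push _ _ (CycLift.lo_mono _ (by omega)), ← CycLift.lo_comp,
    ← CycLift.lo_comp]
  conv_lhs => rw [← mkHom_lift f, ← mkHom_lift g, mkHom_comp]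
  rw [push_mkHom]

theorem map_push {C : Type*} [Monoid C] (φ : B →* C) (f : X ⟶ Y) (b : ZMod X.n → B)
    (w : ZMod Y.n) : φ (push f b w) = push f (fun v => φ (b v)) w := by
  simp only [push, map_iprod]; rfl

theorem push_update_of_ne (f : X ⟶ Y) (b : ZMod X.n → B) (v : ZMod X.n) (x : B) {w : ZMod Y.n}
    (h : w ≠ pt f v) : push f (Function.update b v x) w = push f b w := by
  obtain ⟨w, rfl⟩ := exists_int w
  rw [push_intCast, push_intCast]
  refine iprod_congr fun i h1 h2 => ?_
  have := ((lift f).mem_fibre w i).1 ⟨h1, h2⟩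
  refine Function.update_of_ne ?_ _ _
  rintro rfl
  exact h (by rw [pt_intCast, this])

theorem exists_int_fibre (f : X ⟶ Y) (i : ℤ) (w : ZMod X.n) (h : pt f w = pt f i) :
    ∃ j : ℤ, (j : ZMod X.n) = w ∧ lift f j = lift f i := by
  obtain ⟨j, rfl⟩ := exists_int w
  rw [pt_intCast, pt_intCast, ZMod.intCast_eq_intCast_iff_dvd_sub] at h
  obtain ⟨c, hc⟩ := h
  refine ⟨j + c * X.n, by simp, ?_⟩
  rw [CycLift.per_mul]
  linarith

/-- The product over the part of the fibre of `f` through `i` which precedes `i`. -/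
noncomputable def pre (f : X ⟶ Y) (b : ZMod X.n → B) (i : ℤ) : B :=
  iprod (per b) ((lift f).lo (lift f i)) i

/-- The product over the part of the fibre of `f` through `i` which follows `i`. -/
noncomputable def post (f : X ⟶ Y) (b : ZMod X.n → B) (i : ℤ) : B :=
  iprod (per b) (i + 1) ((lift f).lo (lift f i + 1))

theorem push_split (f : X ⟶ Y) (b : ZMod X.n → B) (i : ℤ) :
    push f b (pt f i) = pre f b i * b i * post f b i := by
  rw [pt_intCast, push_intCast, iprod_split _ (((lift f).mem_fibre _ i).2 rfl).1
    (((lift f).mem_fibre _ i).2 rfl).2]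
  rfl

theorem pre_congr (f : X ⟶ Y) {b b' : ZMod X.n → B} (i : ℤ)
    (h : ∀ v, v ≠ (i : ZMod X.n) → b v = b' v) : pre f b i = pre f b' i := by
  refine iprod_congr fun l h1 h2 => h _ fun he => ?_
  have := (lift f).eq_of_fibre he (((lift f).mem_fibre _ l).1
    ⟨h1, h2.trans (((lift f).mem_fibre _ i).2 rfl).2⟩)
  omega

theorem post_congr (f : X ⟶ Y) {b b' : ZMod X.n → B} (i : ℤ)
    (h : ∀ v, v ≠ (i : ZMod X.n) → b v = b' v) : post f b i = post f b' i := by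
  refine iprod_congr fun l h1 h2 => h _ fun he => ?_
  have := (lift f).eq_of_fibre he (((lift f).mem_fibre _ l).1
    ⟨(((lift f).mem_fibre _ i).2 rfl).1.trans (by omega), h2⟩)
  omega

theorem push_update (f : X ⟶ Y) (b : ZMod X.n → B) (i : ℤ) (x : B) :
    push f (Function.update b (i : ZMod X.n) x) =
      Function.update (push f b) (pt f i) (pre f b i * x * post f b i) := by
  funext w
  by_cases h : w = pt f i
  · subst h
    rw [push_split, Function.update_self, Function.update_self,
      pre_congr f i (b := Function.update b i x) (b' := b)
        (fun v hv => Function.update_of_ne hv _ _),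
      post_congr f i (b := Function.update b i x) (b' := b)
        (fun v hv => Function.update_of_ne hv _ _)]
  · rw [push_update_of_ne _ _ _ _ h, Function.update_of_ne h]

end Cyc

/-! ### The cyclic vector space of an algebra -/

section sharp

variable (k : Type u) [Field k]

/-- `A ^ {⊗ V([n])}`. -/
abbrev Tens (A : Type u) [Ring A] [Algebra k A] (X : Cyc) : Type u := ⨂[k] _ : ZMod X.n, A

variable {A : Type u} [Ring A] [Algebra k A]

/-- The map `⊗_v a_v ↦ ⊗_w m_{f⁻¹(w)} (⊗_{v ∈ f⁻¹(w)} a_v)`. -/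
noncomputable def tensMap {X Y : Cyc} (f : X ⟶ Y) : Tens k A X →ₗ[k] Tens k A Y :=
  PiTensorProduct.lift (MultilinearMap.mk' (fun b => PiTensorProduct.tprod k (Cyc.push f b))
    (fun b v x y => by
      obtain ⟨i, rfl⟩ := Cyc.exists_int v
      simp only [Cyc.push_update, mul_add, add_mul, MultilinearMap.map_update_add])
    (fun b v c x => by
      obtain ⟨i, rfl⟩ := Cyc.exists_int v
      simp only [Cyc.push_update, mul_smul_comm, smul_mul_assoc, MultilinearMap.map_update_smul]))

@[simp]
theorem tensMap_tprod {X Y : Cyc} (f : X ⟶ Y) (b : ZMod X.n → A) :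
    tensMap k f (PiTensorProduct.tprod k b) = PiTensorProduct.tprod k (Cyc.push f b) := by
  simp [tensMap, MultilinearMap.mk']

variable (A) in
/-- The cyclic vector space `A_#`. -/
noncomputable def sharp : Cyc ⥤ ModuleCat.{u} k where
  obj X := ModuleCat.of k (Tens k A X)
  map f := ModuleCat.ofHom (tensMap k f)
  map_id X := by
    ext : 1
    refine PiTensorProduct.ext (MultilinearMap.ext fun b => ?_)
    simp [Cyc.push_id]
  map_comp f g := by
    ext : 1
    refine PiTensorProduct.ext (MultilinearMap.ext fun b => ?_)
    simp [Cyc.push_comp]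

end sharp

/-! ### Simplicial vector spaces, and extension from `Λ_[1]` to `Λ` -/

section jShriek

variable {k : Type u} [Field k]

/-- The Kan extension `j_! E`, with `(j_! E)([n]) = ⨁_{v ∈ V([n])} E(⟨[n], v⟩)`. -/
noncomputable def jShriek (E : PtCyc ⥤ ModuleCat.{u} k) : Cyc ⥤ ModuleCat.{u} k where
  obj X := ModuleCat.of k (⨁ v : ZMod X.n, E.obj ⟨X, v⟩)
  map {X Y} f := ModuleCat.ofHom (DirectSum.toModule k (ZMod X.n) (⨁ w : ZMod Y.n, E.obj ⟨Y, w⟩)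
    fun v => DirectSum.lof k (ZMod Y.n) (fun w => E.obj ⟨Y, w⟩) (Cyc.pt f v) ∘ₗ
      (E.map (PtCyc.homMk f rfl : (⟨X, v⟩ : PtCyc) ⟶ ⟨Y, Cyc.pt f v⟩)).hom)
  map_id X := by
    have key : ∀ (v w : ZMod X.n) (h : Cyc.pt (𝟙 X) v = w) (hw : v = w) (x : E.obj ⟨X, v⟩),
        DirectSum.lof k (ZMod X.n) (fun w => E.obj ⟨X, w⟩) w
          ((E.map (PtCyc.homMk (𝟙 X) h : (⟨X, v⟩ : PtCyc) ⟶ ⟨X, w⟩)).hom x) =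
        DirectSum.lof k (ZMod X.n) (fun w => E.obj ⟨X, w⟩) v x := by
      rintro v _ h rfl x
      have : (PtCyc.homMk (𝟙 X) h : (⟨X, v⟩ : PtCyc) ⟶ ⟨X, v⟩) = 𝟙 _ := rfl
      rw [this, E.map_id]; rfl
    ext : 1
    refine DirectSum.linearMap_ext k fun v => LinearMap.ext fun x => ?_
    simp only [ModuleCat.hom_ofHom, LinearMap.comp_apply, DirectSum.toModule_lof]
    exact key v _ rfl (Cyc.pt_id X v).symm x
  map_comp {X Y Z} f g := by
    have key : ∀ (v : ZMod X.n) (w : ZMod Z.n) (h : Cyc.pt (f ≫ g) v = w)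
        (h' : Cyc.pt g (Cyc.pt f v) = w) (x : E.obj ⟨X, v⟩),
        DirectSum.lof k (ZMod Z.n) (fun w => E.obj ⟨Z, w⟩) (Cyc.pt (f ≫ g) v)
          ((E.map (PtCyc.homMk (f ≫ g) rfl : (⟨X, v⟩ : PtCyc) ⟶ ⟨Z, _⟩)).hom x) =
        DirectSum.lof k (ZMod Z.n) (fun w => E.obj ⟨Z, w⟩) w
          ((E.map (PtCyc.homMk g h' : (⟨Y, Cyc.pt f v⟩ : PtCyc) ⟶ ⟨Z, w⟩)).hom
            ((E.map (PtCyc.homMk f rfl : (⟨X, v⟩ : PtCyc) ⟶ ⟨Y, Cyc.pt f v⟩)).hom x)) := by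
      rintro v _ rfl h' x
      exact congrArg (fun h : E.obj ⟨X, v⟩ ⟶ E.obj ⟨Z, Cyc.pt (f ≫ g) v⟩ =>
        DirectSum.lof k (ZMod Z.n) (fun w => E.obj ⟨Z, w⟩) (Cyc.pt (f ≫ g) v) (h.hom x))
        (E.map_comp (PtCyc.homMk f rfl : (⟨X, v⟩ : PtCyc) ⟶ ⟨Y, Cyc.pt f v⟩) (PtCyc.homMk g h'))
    ext : 1
    refine DirectSum.linearMap_ext k fun v => LinearMap.ext fun x => ?_
    simp only [ModuleCat.hom_ofHom, ModuleCat.hom_comp, LinearMap.comp_apply,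
      DirectSum.toModule_lof]
    exact key v _ (Cyc.pt_comp f g v) rfl x

/-- The map `j_! E ⟶ F` adjoint to `E ⟶ j^* F`. -/
noncomputable def jDesc {E : PtCyc ⥤ ModuleCat.{u} k} {F : Cyc ⥤ ModuleCat.{u} k}
    (φ : E ⟶ PtCyc.j ⋙ F) : jShriek E ⟶ F where
  app X := ModuleCat.ofHom (DirectSum.toModule k (ZMod X.n) (F.obj X)
    fun v => (φ.app ⟨X, v⟩).hom)
  naturality X Y f := by
    ext : 1
    refine DirectSum.linearMap_ext k fun v => LinearMap.ext fun x => ?_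
    have := congrArg (fun h => h.hom x)
      (φ.naturality (PtCyc.homMk f rfl : (⟨X, v⟩ : PtCyc) ⟶ ⟨Y, Cyc.pt f v⟩))
    simp only [jShriek, ModuleCat.hom_ofHom, ModuleCat.hom_comp, LinearMap.comp_apply]
    rw [DirectSum.toModule_lof]
    erw [DirectSum.toModule_lof, DirectSum.toModule_lof]
    exact this

theorem jDesc_lof {E : PtCyc ⥤ ModuleCat.{u} k} {F : Cyc ⥤ ModuleCat.{u} k}
    (φ : E ⟶ PtCyc.j ⋙ F) (X : Cyc) (v : ZMod X.n) (x : E.obj ⟨X, v⟩) :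
    ((jDesc φ).app X).hom (DirectSum.lof k (ZMod X.n) (fun w => E.obj ⟨X, w⟩) v x) =
      (φ.app ⟨X, v⟩).hom x :=
  DirectSum.toModule_lof _ _ _

end jShriek

/-! ### The simplicial vector space of a bimodule -/

section MDelta

variable (k : Type u) [Field k] {A : Type u} [Ring A] [Algebra k A]
variable (M : Type u) [AddCommGroup M] [Module k M] [Module A M] [Module Aᵐᵒᵖ M]
  [SMulCommClass A Aᵐᵒᵖ M] [IsScalarTower k A M] [IsScalarTower k Aᵐᵒᵖ M]

/-- `M ⊗ A ^ {⊗ (V([n]) ∖ {v})}`. -/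
abbrev MTens (A : Type u) [Ring A] [Algebra k A] (P : PtCyc) : Type u :=
  M ⊗[k] (⨂[k] _ : {w : ZMod P.base.n // w ≠ P.v}, A)

variable {M}

/-- The family with `m` at the point `v` and with the elements `b w` of `A` at the other points,
seen as a family of elements of the algebra `A ⊕ M`, `M² = 0`. In this algebra the product
`a₁ * ⋯ * m * ⋯ * aᵣ` is the image of `m` under the bimodule action on `M`. -/
noncomputable def mixed {n : ℕ} {v : ZMod n} (m : M) (b : {w : ZMod n // w ≠ v} → A) :
    ZMod n → TrivSqZeroExt A M :=
  fun w => if h : w = v then TrivSqZeroExt.inr m else TrivSqZeroExt.inl (b ⟨w, h⟩)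

theorem mixed_update {n : ℕ} {v : ZMod n} (m : M) (b : {w : ZMod n // w ≠ v} → A)
    (w : {w : ZMod n // w ≠ v}) (x : A) :
    mixed m (Function.update b w x) = Function.update (mixed m b) w.1 (TrivSqZeroExt.inl x) := by
  funext u
  by_cases hu : u = w.1
  · subst hu; simp [mixed, w.2]
  · rw [Function.update_of_ne hu]
    by_cases hv : u = v
    · simp [mixed, hv]
    · simp only [mixed, hv, dite_false]
      rw [Function.update_of_ne (fun h => hu (congrArg Subtype.val h))]

theorem fst_update_self {n : ℕ} {v : ZMod n} (c : ZMod n → TrivSqZeroExt A M)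
    (x : TrivSqZeroExt A M) :
    (fun w : {w : ZMod n // w ≠ v} => (Function.update c v x w.1).fst) = fun w => (c w.1).fst := by
  funext w
  rw [Function.update_of_ne w.2]

theorem fst_update_of_ne {n : ℕ} {v : ZMod n} (c : ZMod n → TrivSqZeroExt A M)
    {u : ZMod n} (hu : u ≠ v) (x : TrivSqZeroExt A M) :
    (fun w : {w : ZMod n // w ≠ v} => (Function.update c u x w.1).fst) =
      Function.update (fun w : {w : ZMod n // w ≠ v} => (c w.1).fst) ⟨u, hu⟩ x.fst := by
  funext w
  by_cases h : w = ⟨u, hu⟩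
  · subst h; simp
  · rw [Function.update_of_ne h, Function.update_of_ne (fun h' => h (Subtype.ext h'))]

/-- A family of elements of `A ⊕ M` which lies in `M` at `v` and in `A` elsewhere. -/
def IsMixed {n : ℕ} (v : ZMod n) (c : ZMod n → TrivSqZeroExt A M) : Prop :=
  (c v).fst = 0 ∧ ∀ w, w ≠ v → (c w).snd = 0

theorem isMixed_mixed {n : ℕ} {v : ZMod n} (m : M) (b : {w : ZMod n // w ≠ v} → A) :
    IsMixed v (mixed m b) :=
  ⟨by simp [mixed], fun w h => by simp [mixed, h]⟩

theorem mixed_eta {n : ℕ} {v : ZMod n} {c : ZMod n → TrivSqZeroExt A M} (h : IsMixed v c) :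
    mixed (c v).snd (fun w : {w : ZMod n // w ≠ v} => (c w).fst) = c := by
  funext w
  by_cases hw : w = v
  · subst hw
    ext <;> simp [mixed, h.1]
  · ext <;> simp [mixed, hw, h.2 w hw]

theorem IsMixed.push {X Y : Cyc} (f : X ⟶ Y) {v : ZMod X.n} {c : ZMod X.n → TrivSqZeroExt A M}
    (h : IsMixed v c) : IsMixed (Cyc.pt f v) (Cyc.push f c) := by
  constructor
  · obtain ⟨i, rfl⟩ := Cyc.exists_int v
    rw [Cyc.push_split]
    simp [h.1]
  · intro w hw
    have : Cyc.push f c w = TrivSqZeroExt.inlHom A M (Cyc.push f (fun v => (c v).fst) w) := by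
      have h1 := Cyc.push_update_of_ne f c v 1 hw
      rw [← h1]
      have h2 := Cyc.push_update_of_ne f (fun v => (c v).fst) v 1 hw
      rw [← h2]
      refine Eq.trans ?_ (Cyc.map_push (TrivSqZeroExt.inlHom A M : A →* TrivSqZeroExt A M) f _ w).symm
      congr 1
      funext x
      by_cases hx : x = v
      · subst hx; simp
      · ext <;> simp [hx, h.2 x hx]
    rw [this]
    simp

/-- The inclusion `M ⊗ A ^ {⊗ (V([n]) ∖ {v})} → (A ⊕ M) ^ {⊗ V([n])}`, with `M` at the place `v`. -/
noncomputable def mixedIncl (P : PtCyc) : MTens k M A P →ₗ[k] Tens k (TrivSqZeroExt A M) P.base :=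
  TensorProduct.lift (PiTensorProduct.lift (MultilinearMap.mk'
    (fun b =>
      { toFun := fun m => PiTensorProduct.tprod k (mixed m b)
        map_add' := fun m m' => by
          have h : ∀ m : M, mixed m b = Function.update (mixed 0 b) P.v (TrivSqZeroExt.inr m) := by
            intro m; funext w; by_cases hw : w = P.v
            · subst hw; simp [mixed]
            · simp [mixed, hw]
          rw [h, h m, h m', TrivSqZeroExt.inr_add, MultilinearMap.map_update_add]
        map_smul' := fun c m => by
          have h : ∀ m : M, mixed m b = Function.update (mixed 0 b) P.v (TrivSqZeroExt.inr m) := by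
            intro m; funext w; by_cases hw : w = P.v
            · subst hw; simp [mixed]
            · simp [mixed, hw]
          rw [h, h m, TrivSqZeroExt.inr_smul, MultilinearMap.map_update_smul]; rfl } :
      ({w : ZMod P.base.n // w ≠ P.v} → A) → M →ₗ[k] Tens k (TrivSqZeroExt A M) P.base)
    (fun b w x y => by
      ext m
      simp only [LinearMap.coe_mk, AddHom.coe_mk, LinearMap.add_apply, mixed_update,
        TrivSqZeroExt.inl_add, MultilinearMap.map_update_add])
    (fun b w c x => by
      ext m
      simp only [LinearMap.coe_mk, AddHom.coe_mk, LinearMap.smul_apply, mixed_update,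
        TrivSqZeroExt.inl_smul, MultilinearMap.map_update_smul]))).flip

theorem mixedIncl_tmul (P : PtCyc) (m : M) (b : {w : ZMod P.base.n // w ≠ P.v} → A) :
    mixedIncl k P (m ⊗ₜ[k] PiTensorProduct.tprod k b) = PiTensorProduct.tprod k (mixed m b) := by
  simp [mixedIncl, MultilinearMap.mk']

/-- The projection `(A ⊕ M) ^ {⊗ V([n])} → M ⊗ A ^ {⊗ (V([n]) ∖ {v})}`. -/
noncomputable def mixedProj (P : PtCyc) : Tens k (TrivSqZeroExt A M) P.base →ₗ[k] MTens k M A P :=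
  PiTensorProduct.lift (MultilinearMap.mk'
    (fun c => (c P.v).snd ⊗ₜ[k] PiTensorProduct.tprod k
      (fun w : {w : ZMod P.base.n // w ≠ P.v} => (c w.1).fst))
    (fun c w x y => by
      by_cases hw : w = P.v
      · subst hw
        simp only [Function.update_self, TrivSqZeroExt.snd_add, TensorProduct.add_tmul,
          fst_update_self]
      · simp only [Function.update_of_ne (Ne.symm hw), fst_update_of_ne c hw,
          TrivSqZeroExt.fst_add, MultilinearMap.map_update_add, TensorProduct.tmul_add])
    (fun c w r x => by
      by_cases hw : w = P.v
      · subst hw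
        simp only [Function.update_self, TrivSqZeroExt.snd_smul, TensorProduct.smul_tmul',
          fst_update_self]
      · simp only [Function.update_of_ne (Ne.symm hw), fst_update_of_ne c hw,
          TrivSqZeroExt.fst_smul, MultilinearMap.map_update_smul, TensorProduct.tmul_smul]))

theorem mixedProj_tprod (P : PtCyc) (c : ZMod P.base.n → TrivSqZeroExt A M) :
    mixedProj k P (PiTensorProduct.tprod k c) = (c P.v).snd ⊗ₜ[k] PiTensorProduct.tprod k
      (fun w : {w : ZMod P.base.n // w ≠ P.v} => (c w.1).fst) := by
  simp [mixedProj, MultilinearMap.mk']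

theorem mixedIncl_mixedProj (P : PtCyc) {c : ZMod P.base.n → TrivSqZeroExt A M}
    (h : IsMixed P.v c) :
    mixedIncl k P (mixedProj k P (PiTensorProduct.tprod k c)) = PiTensorProduct.tprod k c := by
  rw [mixedProj_tprod, mixedIncl_tmul, mixed_eta h]

theorem MTens.ext {P : PtCyc} {N : Type*} [AddCommMonoid N] [Module k N]
    {φ ψ : MTens k M A P →ₗ[k] N}
    (h : ∀ c : ZMod P.base.n → TrivSqZeroExt A M, IsMixed P.v c →
      φ (mixedProj k P (PiTensorProduct.tprod k c)) =
        ψ (mixedProj k P (PiTensorProduct.tprod k c))) : φ = ψ := by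
  refine TensorProduct.ext (LinearMap.ext fun m => PiTensorProduct.ext
    (MultilinearMap.ext fun b => ?_))
  have := h (mixed m b) (isMixed_mixed m b)
  rw [mixedProj_tprod] at this
  have h1 : (mixed (v := P.v) m b P.v).snd = m := by simp [mixed]
  have h2 : (fun w : {w : ZMod P.base.n // w ≠ P.v} => (mixed (v := P.v) m b w.1).fst) = b := by
    funext w; simp [mixed, w.2]
  rw [h1, h2] at this
  exact this

variable (A M) in
/-- The simplicial vector space `M^Δ_#` of an `A`-bimodule `M`: its structure maps are given by
the same formula as those of `A_#`, with the element of `M` at the distinguished point, and with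
the actions of `A` on `M` as multiplication. -/
noncomputable def mDelta : PtCyc ⥤ ModuleCat.{u} k where
  obj P := ModuleCat.of k (MTens k M A P)
  map {P Q} f := ModuleCat.ofHom (mixedProj k Q ∘ₗ tensMap k f.1 ∘ₗ mixedIncl k P)
  map_id P := by
    ext : 1
    refine MTens.ext k fun c hc => ?_
    have : (𝟙 P : P ⟶ P).1 = 𝟙 P.base := rfl
    simp [mixedIncl_mixedProj k P hc, this, Cyc.push_id]
  map_comp {P Q R} f g := by
    ext : 1
    refine MTens.ext k fun c hc => ?_
    have h : IsMixed Q.v (Cyc.push f.1 c) := by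
      have h := hc.push f.1
      rwa [f.2] at h
    have : (f ≫ g).1 = f.1 ≫ g.1 := rfl
    simp [mixedIncl_mixedProj k P hc, mixedIncl_mixedProj k Q h, this, Cyc.push_comp]

theorem mDelta_map_mixedProj {P Q : PtCyc} (f : P ⟶ Q) {c : ZMod P.base.n → TrivSqZeroExt A M}
    (hc : IsMixed P.v c) :
    ((mDelta k A M).map f).hom (mixedProj k P (PiTensorProduct.tprod k c)) =
      mixedProj k Q (PiTensorProduct.tprod k (Cyc.push f.1 c)) :=
  congrArg (mixedProj k Q) ((congrArg (tensMap k f.1) (mixedIncl_mixedProj k P hc)).trans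
    (tensMap_tprod k f.1 c))

end MDelta

/-! ### Square-zero extensions -/

section SquareZero

/-- A square-zero extension `0 → M → Ã → A → 0` of `A` by the bimodule `M`. -/
structure SquareZeroExtension (k A M E : Type u) [Field k] [Ring A] [Algebra k A]
    [AddCommGroup M] [Module k M] [Module A M] [Module Aᵐᵒᵖ M] [Ring E] [Algebra k E] where
  p : E →ₐ[k] A
  i : M →ₗ[k] E
  surjective : Function.Surjective p
  injective : Function.Injective i
  exact : ∀ x, p x = 0 ↔ ∃ m, i m = x
  mul_i : ∀ x m, x * i m = i (p x • m)
  i_mul : ∀ m x, i m * x = i (MulOpposite.op (p x) • m)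

variable {k A M E : Type u} [Field k] [Ring A] [Algebra k A]
  [AddCommGroup M] [Module k M] [Module A M] [Module Aᵐᵒᵖ M]
  [SMulCommClass A Aᵐᵒᵖ M] [IsScalarTower k A M] [IsScalarTower k Aᵐᵒᵖ M]
  [Ring E] [Algebra k E]

section

variable {A B : Type u} [Ring A] [Algebra k A] [Ring B] [Algebra k B] (φ : A →ₐ[k] B)

/-- The tensor power of an algebra map. -/
noncomputable def tensAlg (X : Cyc) : Tens k A X →ₗ[k] Tens k B X :=
  PiTensorProduct.map fun _ : ZMod X.n => φ.toLinearMap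

@[simp]
theorem tensAlg_tprod (X : Cyc) (b : ZMod X.n → A) :
    tensAlg φ X (PiTensorProduct.tprod k b) = PiTensorProduct.tprod k (fun v => φ (b v)) := by
  simp [tensAlg, PiTensorProduct.map_tprod]

theorem tensAlg_tensMap {X Y : Cyc} (f : X ⟶ Y) :
    tensAlg φ Y ∘ₗ tensMap k f = tensMap k f ∘ₗ tensAlg φ X := by
  refine PiTensorProduct.ext (MultilinearMap.ext fun b => ?_)
  simp only [LinearMap.compMultilinearMap_apply, LinearMap.comp_apply, tensMap_tprod,
    tensAlg_tprod]
  congr 1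
  funext w
  exact Cyc.map_push (φ : A →* B) f b w

end

namespace SquareZeroExtension

variable (S : SquareZeroExtension k A M E)

/-- The filtration `F^j` on `Ã ^ {⊗ n}` induced by `F^0 Ã = Ã`, `F^1 Ã = M`, `F^2 Ã = 0`: it is
spanned by the pure tensors with at least `j` factors in `M = Ker p`. -/
def filt (j : ℕ) (X : Cyc) : Submodule k (Tens k E X) :=
  Submodule.span k {t | ∃ (b : ZMod X.n → E) (T : Finset (ZMod X.n)), j ≤ T.card ∧
    (∀ v ∈ T, S.p (b v) = 0) ∧ t = PiTensorProduct.tprod k b}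

theorem mul_eq_zero_of_ker {x y : E} (hx : S.p x = 0) (hy : S.p y = 0) : x * y = 0 := by
  obtain ⟨m, rfl⟩ := (S.exact y).1 hy
  rw [S.mul_i, hx, zero_smul, map_zero]

theorem mem_filt_two {X : Cyc} (b : ZMod X.n → E) {v w : ZMod X.n} (h : v ≠ w)
    (hv : S.p (b v) = 0) (hw : S.p (b w) = 0) : PiTensorProduct.tprod k b ∈ S.filt 2 X :=
  Submodule.subset_span ⟨b, {v, w}, by rw [Finset.card_pair h], by simp [hv, hw], rfl⟩

theorem p_push_eq_zero {X Y : Cyc} (f : X ⟶ Y) (b : ZMod X.n → E) (v : ZMod X.n)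
    (hv : S.p (b v) = 0) : S.p (Cyc.push f b (Cyc.pt f v)) = 0 := by
  obtain ⟨i, rfl⟩ := Cyc.exists_int v
  rw [Cyc.push_split, map_mul, map_mul, hv, mul_zero, zero_mul]

theorem push_eq_zero {X Y : Cyc} (f : X ⟶ Y) (b : ZMod X.n → E) {v w : ZMod X.n} (h : v ≠ w)
    (hv : S.p (b v) = 0) (hw : S.p (b w) = 0) (he : Cyc.pt f v = Cyc.pt f w) :
    Cyc.push f b (Cyc.pt f v) = 0 := by
  obtain ⟨i, rfl⟩ := Cyc.exists_int v
  obtain ⟨j, rfl, hj⟩ := Cyc.exists_int_fibre f i w he.symm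
  have hij : j ≠ i := by rintro rfl; exact h rfl
  have hi := ((Cyc.lift f).mem_fibre _ i).2 rfl
  have hj' := ((Cyc.lift f).mem_fibre _ j).2 hj
  rw [Cyc.push_split]
  rcases lt_or_gt_of_ne hij with hlt | hlt
  · have : S.p (Cyc.pre f b i) = 0 := by
      rw [Cyc.pre, iprod_split _ hj'.1 hlt, map_mul, map_mul]
      simp [Cyc.per, hw]
    rw [S.mul_eq_zero_of_ker this hv, zero_mul]
  · have : S.p (Cyc.post f b i) = 0 := by
      rw [Cyc.post, iprod_split _ (show i + 1 ≤ j by omega) hj'.2, map_mul, map_mul]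
      simp [Cyc.per, hw]
    rw [mul_assoc, S.mul_eq_zero_of_ker hv this, mul_zero]

theorem filt_two_le {X Y : Cyc} (f : X ⟶ Y) :
    S.filt 2 X ≤ (S.filt 2 Y).comap (tensMap k f) := by
  refine Submodule.span_le.2 ?_
  rintro _ ⟨b, T, hT, hb, rfl⟩
  obtain ⟨v, hv, w, hw, h⟩ := Finset.one_lt_card.1 hT
  simp only [Submodule.comap_coe, Set.mem_preimage, SetLike.mem_coe, tensMap_tprod]
  by_cases he : Cyc.pt f v = Cyc.pt f w
  · have h0 := S.push_eq_zero f b h (hb v hv) (hb w hw) he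
    rw [(PiTensorProduct.tprod k).map_coord_zero (Cyc.pt f v) h0]
    exact zero_mem _
  · exact S.mem_filt_two _ he (S.p_push_eq_zero f b v (hb v hv)) (S.p_push_eq_zero f b w (hb w hw))

/-- The cyclic vector space `\overline{A_#} = Ã_# / F² Ã_#`. -/
noncomputable def bar : Cyc ⥤ ModuleCat.{u} k where
  obj X := ModuleCat.of k (Tens k E X ⧸ S.filt 2 X)
  map f := ModuleCat.ofHom (Submodule.mapQ _ _ (tensMap k f) (S.filt_two_le f))
  map_id X := by
    ext : 1
    refine Submodule.linearMap_qext _ (PiTensorProduct.ext (MultilinearMap.ext fun b => ?_))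
    simp [Cyc.push_id]
  map_comp f g := by
    ext : 1
    refine Submodule.linearMap_qext _ (PiTensorProduct.ext (MultilinearMap.ext fun b => ?_))
    simp [Cyc.push_comp]

/-- The class in `\overline{A_#}` of a pure tensor. -/
noncomputable def cls {X : Cyc} (b : ZMod X.n → E) : S.bar.obj X :=
  (S.filt 2 X).mkQ (PiTensorProduct.tprod k b)

theorem bar_map_cls {X Y : Cyc} (f : X ⟶ Y) (b : ZMod X.n → E) :
    (S.bar.map f).hom (S.cls b) = S.cls (Cyc.push f b) := by
  exact congrArg (S.filt 2 Y).mkQ (tensMap_tprod k f b)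

theorem filt_two_le_ker (X : Cyc) : S.filt 2 X ≤ LinearMap.ker (tensAlg S.p X) := by
  refine Submodule.span_le.2 ?_
  rintro _ ⟨b, T, hT, hb, rfl⟩
  obtain ⟨v, hv, -⟩ := Finset.one_lt_card.1 hT
  rw [SetLike.mem_coe, LinearMap.mem_ker, tensAlg_tprod]
  exact (PiTensorProduct.tprod k).map_coord_zero v (hb v hv)

/-- The projection `\overline{A_#} ⟶ A_#`. -/
noncomputable def barProj : S.bar ⟶ sharp k A where
  app X := ModuleCat.ofHom (Submodule.liftQ (S.filt 2 X) (tensAlg S.p X) (S.filt_two_le_ker X))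
  naturality X Y f := by
    ext : 1
    refine Submodule.linearMap_qext _ (LinearMap.ext fun x => ?_)
    exact LinearMap.congr_fun (tensAlg_tensMap S.p f) x

theorem barProj_cls {X : Cyc} (b : ZMod X.n → E) :
    (S.barProj.app X).hom (S.cls b) = PiTensorProduct.tprod k (fun v => S.p (b v)) := by
  rw [← tensAlg_tprod]; rfl

theorem cls_update_add {X : Cyc} (b : ZMod X.n → E) (v : ZMod X.n) (x y : E) :
    S.cls (Function.update b v (x + y)) =
      S.cls (Function.update b v x) + S.cls (Function.update b v y) := by
  simp only [cls, MultilinearMap.map_update_add, map_add]; rfl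

theorem cls_update_smul {X : Cyc} (b : ZMod X.n → E) (v : ZMod X.n) (r : k) (x : E) :
    S.cls (Function.update b v (r • x)) = r • S.cls (Function.update b v x) := by
  simp only [cls, MultilinearMap.map_update_smul, map_smul]; rfl

theorem cls_eq_zero {X : Cyc} (b : ZMod X.n → E) {v w : ZMod X.n} (h : v ≠ w)
    (hv : S.p (b v) = 0) (hw : S.p (b w) = 0) : S.cls b = 0 :=
  (Submodule.Quotient.mk_eq_zero _).2 (S.mem_filt_two b h hv hw)

/-- The class of a pure tensor with a factor in `M` depends on the other factors only through
their images in `A`. -/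
theorem cls_congr {X : Cyc} (b c : ZMod X.n → E) (v : ZMod X.n) (hv : S.p (b v) = 0)
    (hbc : b v = c v) (h : ∀ w, S.p (b w) = S.p (c w)) : S.cls b = S.cls c := by
  have key : ∀ T : Finset (ZMod X.n), v ∉ T → S.cls (T.piecewise c b) = S.cls b := by
    intro T
    induction T using Finset.induction with
    | empty => simp
    | insert w T hw ih =>
      intro hvT
      rw [Finset.mem_insert, not_or] at hvT
      rw [Finset.piecewise_insert]
      have h1 : c w = b w + (c w - b w) := by abel
      have h2 : Function.update (T.piecewise c b) w (b w) = T.piecewise c b := by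
        rw [Function.update_eq_self_iff, Finset.piecewise_eq_of_notMem _ _ _ hw]
      rw [h1, cls_update_add, h2, ih hvT.2, add_eq_left]
      refine S.cls_eq_zero _ (v := v) (w := w) hvT.1 ?_ ?_
      · rw [Function.update_of_ne hvT.1, Finset.piecewise_eq_of_notMem _ _ _ hvT.2, hv]
      · simp [h w]
  have := key (Finset.univ.erase v) (by simp)
  rw [← this]
  congr 1
  funext w
  by_cases hw : w = v
  · subst hw; simp [hbc]
  · rw [Finset.piecewise_eq_of_mem _ _ _ (by simp [hw])]

/-- Lifts of elements of `A` to `Ã`. -/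
noncomputable def σ (a : A) : E := Function.surjInv S.surjective a

theorem p_σ (a : A) : S.p (S.σ a) = a := Function.surjInv_eq S.surjective a

theorem p_i (m : M) : S.p (S.i m) = 0 := (S.exact _).2 ⟨m, rfl⟩

/-- The family with `m` at `v` and with lifts of the elements `b w` of `A` at the other points. -/
noncomputable def liftFam {n : ℕ} {v : ZMod n} (m : M) (b : {w : ZMod n // w ≠ v} → A) :
    ZMod n → E :=
  fun w => if h : w = v then S.i m else S.σ (b ⟨w, h⟩)

theorem cls_liftFam_update {X : Cyc} {v : ZMod X.n} (m : M) (b : {w : ZMod X.n // w ≠ v} → A)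
    (w : {w : ZMod X.n // w ≠ v}) (a : A) (e : E) (he : S.p e = a) :
    S.cls (S.liftFam m (Function.update b w a)) =
      S.cls (Function.update (S.liftFam m b) w.1 e) := by
  refine S.cls_congr _ _ v (by simp [liftFam, p_i]) ?_ ?_
  · rw [Function.update_of_ne w.2.symm]; simp [liftFam]
  · intro u
    by_cases hu : u = w.1
    · subst hu; simp [liftFam, w.2, p_σ, he]
    · rw [Function.update_of_ne hu]
      by_cases huv : u = v
      · simp [liftFam, huv]
      · have : (⟨u, huv⟩ : {w : ZMod X.n // w ≠ v}) ≠ w := fun h => hu (congrArg Subtype.val h)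
        simp [liftFam, huv, Function.update_of_ne this]

theorem liftFam_eq_update {n : ℕ} {v : ZMod n} (m : M) (b : {w : ZMod n // w ≠ v} → A) :
    S.liftFam m b = Function.update (S.liftFam 0 b) v (S.i m) := by
  funext w
  by_cases h : w = v
  · subst h; simp [liftFam]
  · simp [liftFam, h]

/-- The map sending `m ⊗ (⊗ a_w)` to the class of the tensor with `m` at the distinguished point
and with arbitrary lifts of the `a_w` to `Ã` at the other points. -/
noncomputable def deltaInclAux (P : PtCyc) : MTens k M A P →ₗ[k] S.bar.obj P.base :=
  TensorProduct.lift (PiTensorProduct.lift (MultilinearMap.mk'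
    (fun b =>
      { toFun := fun m => S.cls (S.liftFam m b)
        map_add' := fun m m' => by
          rw [S.liftFam_eq_update, S.liftFam_eq_update m, S.liftFam_eq_update m', map_add,
            cls_update_add]
        map_smul' := fun c m => by
          rw [S.liftFam_eq_update, S.liftFam_eq_update m, map_smul, cls_update_smul]; rfl } :
      ({w : ZMod P.base.n // w ≠ P.v} → A) → M →ₗ[k] S.bar.obj P.base)
    (fun b w x y => by
      ext m
      simp only [LinearMap.coe_mk, AddHom.coe_mk, LinearMap.add_apply]
      rw [S.cls_liftFam_update m b w (x + y) (S.σ x + S.σ y) (by simp [p_σ]),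
        S.cls_liftFam_update m b w x (S.σ x) (S.p_σ x),
        S.cls_liftFam_update m b w y (S.σ y) (S.p_σ y), cls_update_add])
    (fun b w c x => by
      ext m
      simp only [LinearMap.coe_mk, AddHom.coe_mk, LinearMap.smul_apply]
      rw [S.cls_liftFam_update m b w (c • x) (c • S.σ x) (by simp [p_σ]),
        S.cls_liftFam_update m b w x (S.σ x) (S.p_σ x), cls_update_smul]))).flip

theorem deltaInclAux_tmul (P : PtCyc) (m : M) (b : {w : ZMod P.base.n // w ≠ P.v} → A) :
    S.deltaInclAux P (m ⊗ₜ[k] PiTensorProduct.tprod k b) = S.cls (S.liftFam m b) := by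
  simp [deltaInclAux, MultilinearMap.mk']

/-- `IsLiftOf c e`: the family `e` in `Ã` lifts the mixed family `c` in `A ⊕ M`. -/
def IsLiftOf {n : ℕ} (v : ZMod n) (c : ZMod n → TrivSqZeroExt A M) (e : ZMod n → E) : Prop :=
  e v = S.i (c v).snd ∧ ∀ w, w ≠ v → S.p (e w) = (c w).fst

theorem isLiftOf_liftFam {n : ℕ} {v : ZMod n} (c : ZMod n → TrivSqZeroExt A M) :
    S.IsLiftOf v c
      (S.liftFam (v := v) (c v).snd (fun w : {w : ZMod n // w ≠ v} => (c w.1).fst)) :=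
  ⟨by simp [liftFam], fun w hw => by simp [liftFam, hw, p_σ]⟩

theorem deltaInclAux_mixedProj (P : PtCyc) {c : ZMod P.base.n → TrivSqZeroExt A M}
    {e : ZMod P.base.n → E} (h : S.IsLiftOf P.v c e) :
    S.deltaInclAux P (mixedProj k P (PiTensorProduct.tprod k c)) = S.cls e := by
  rw [mixedProj_tprod, deltaInclAux_tmul]
  obtain ⟨h1, h2⟩ := S.isLiftOf_liftFam (v := P.v) c
  refine S.cls_congr _ _ P.v (by rw [h1, p_i]) (by rw [h1, h.1]) fun w => ?_
  by_cases hw : w = P.v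
  · subst hw; rw [h1, h.1]
  · rw [h2 w hw, h.2 w hw]

theorem IsLiftOf.push {X Y : Cyc} (f : X ⟶ Y) {v : ZMod X.n} {c : ZMod X.n → TrivSqZeroExt A M}
    {e : ZMod X.n → E} (hc : IsMixed v c) (h : S.IsLiftOf v c e) :
    S.IsLiftOf (Cyc.pt f v) (Cyc.push f c) (Cyc.push f e) := by
  have hp : ∀ w, S.p (e w) = (c w).fst := fun w => by
    by_cases hw : w = v
    · subst hw; rw [h.1, p_i, hc.1]
    · exact h.2 w hw
  have hpre : ∀ x y, S.p (iprod (Cyc.per e) x y) = (iprod (Cyc.per c) x y).fst := fun x y => by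
    refine (map_iprod (S.p : E →* A) _ _ _).trans (Eq.trans ?_
      (map_iprod (TrivSqZeroExt.fstHom k A M : TrivSqZeroExt A M →* A) _ _ _).symm)
    exact iprod_congr fun i _ _ => hp _
  constructor
  · obtain ⟨i, rfl⟩ := Cyc.exists_int v
    have hci : c i = TrivSqZeroExt.inr (c i).snd := by ext <;> simp [hc.1]
    rw [Cyc.push_split, Cyc.push_split, h.1, S.mul_i, S.i_mul, Cyc.pre, Cyc.post, hpre, hpre, hci]
    simp [Cyc.pre, Cyc.post]
  · intro w _
    exact hpre _ _

/-- The map `M^Δ_# ⟶ j^* \overline{A_#}`. -/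
noncomputable def deltaIncl : mDelta k A M ⟶ PtCyc.j ⋙ S.bar where
  app P := ModuleCat.ofHom (S.deltaInclAux P)
  naturality P Q f := by
    ext : 1
    refine MTens.ext k fun c hc => ?_
    have hl := S.isLiftOf_liftFam (v := P.v) c
    have hl' := IsLiftOf.push S f.1 hc hl
    rw [f.2] at hl'
    have h1 := S.deltaInclAux_mixedProj Q hl'
    have h2 := S.deltaInclAux_mixedProj P hl
    refine (congrArg (S.deltaInclAux Q) (mDelta_map_mixedProj k f hc)).trans (h1.trans ?_)
    refine (S.bar_map_cls f.1 _).symm.trans ?_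
    rw [← h2]
    rfl

/-- The inclusion `j_! M^Δ_# ⟶ \overline{A_#}`. -/
noncomputable def barIncl : jShriek (mDelta k A M) ⟶ S.bar := jDesc S.deltaIncl

theorem barIncl_barProj : S.barIncl ≫ S.barProj = 0 := by
  ext X : 3
  refine DirectSum.linearMap_ext k fun v => MTens.ext k fun c hc => ?_
  have hl := S.isLiftOf_liftFam (v := v) c
  have h1 := jDesc_lof S.deltaIncl X v (mixedProj k ⟨X, v⟩ (PiTensorProduct.tprod k c))
  have h2 := S.deltaInclAux_mixedProj ⟨X, v⟩ hl
  refine (congrArg (S.barProj.app X).hom (h1.trans h2)).trans ?_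
  rw [barProj_cls]
  exact (PiTensorProduct.tprod k).map_coord_zero v (by rw [hl.1, p_i])

end SquareZeroExtension

end SquareZero

/-! ### Cyclic bimodules -/

section Bimodules

/-- A `B`-bimodule structure (over `k`) on the vector space `N`. -/
structure BimodStr (k B N : Type u) [Field k] [Ring B] [Algebra k B] [AddCommGroup N]
    [Module k N] where
  left : B →ₐ[k] Module.End k N
  right : Bᵐᵒᵖ →ₐ[k] Module.End k N
  comm : ∀ b c x, left b (right c x) = right c (left b x)

variable {k A : Type u} [Field k] [Ring A] [Algebra k A]

section

variable {N : Type u} [AddCommGroup N] [Module k N] {X : Cyc}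

/-- Left multiplication by `a_v = 1 ⊗ ⋯ ⊗ a ⊗ ⋯ ⊗ 1`, with `a` at the `v`-th place. -/
noncomputable def BimodStr.leftAt (S : BimodStr k (Tens k A X) N) (v : ZMod X.n) (a : A) :
    Module.End k N :=
  S.left (PiTensorProduct.singleAlgHom (R := k) (A := fun _ : ZMod X.n => A) v a)

/-- Right multiplication by `a_v = 1 ⊗ ⋯ ⊗ a ⊗ ⋯ ⊗ 1`, with `a` at the `v`-th place. -/
noncomputable def BimodStr.rightAt (S : BimodStr k (Tens k A X) N) (v : ZMod X.n) (a : A) :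
    Module.End k N :=
  S.right (MulOpposite.op
    (PiTensorProduct.singleAlgHom (R := k) (A := fun _ : ZMod X.n => A) v a))

end

section

variable {N : Type u} [AddCommGroup N] [Module k N] {N' : Type u} [AddCommGroup N'] [Module k N']
  {X Y : Cyc}

/-- Let `N` be an `A^{⊗ V(X)}`-bimodule and `N'` an `A^{⊗ V(Y)}`-bimodule. The conditions on a
linear map `φ : N → N'` which say that it comes from a map of `A^{⊗ V(Y)}`-bimodules `f_! N → N'`,
where `f_! = ∏_w m_{f⁻¹(w)}` is the transition functor. They are indexed by the pairs `i, i + 1` of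
consecutive marked points: if these lie in the same fibre of `f`, then `φ` is balanced with respect
to the right action at `i` and the left action at `i + 1` (a tensor product over `A` is formed);
if not, then `i` is the last point of its fibre, `i + 1` is the first point of its fibre, the
corresponding actions are preserved by `φ`, and for each `w` strictly between the images, where the
fibre is empty and the component of `f_! N` is the unit bimodule `A`, the left and the right actions
at `w` agree on the image of `φ`. -/
structure IsOver (f : X ⟶ Y) (S : BimodStr k (Tens k A X) N) (S' : BimodStr k (Tens k A Y) N')
    (φ : N →ₗ[k] N') : Prop where
  balanced : ∀ (i : ℤ) (a : A) (x : N), Cyc.lift f i = Cyc.lift f (i + 1) →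
    φ (S.leftAt ((i + 1 : ℤ) : ZMod X.n) a x) = φ (S.rightAt (i : ZMod X.n) a x)
  map_right : ∀ (i : ℤ) (a : A) (x : N), Cyc.lift f i < Cyc.lift f (i + 1) →
    φ (S.rightAt (i : ZMod X.n) a x) = S'.rightAt (Cyc.lift f i : ZMod Y.n) a (φ x)
  map_left : ∀ (i : ℤ) (a : A) (x : N), Cyc.lift f i < Cyc.lift f (i + 1) →
    φ (S.leftAt ((i + 1 : ℤ) : ZMod X.n) a x) =
      S'.leftAt (Cyc.lift f (i + 1) : ZMod Y.n) a (φ x)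
  unit : ∀ (i w : ℤ) (a : A) (x : N), Cyc.lift f i < w → w < Cyc.lift f (i + 1) →
    S'.leftAt (w : ZMod Y.n) a (φ x) = S'.rightAt (w : ZMod Y.n) a (φ x)

/-- The map `φ` over `f` is cocartesian: it is universal among the maps over `f` with source `N`,
that is, the corresponding map of bimodules `f_! N → N'` is an isomorphism. -/
def IsCocartesian (f : X ⟶ Y) (S : BimodStr k (Tens k A X) N) (S' : BimodStr k (Tens k A Y) N')
    (φ : N →ₗ[k] N') : Prop :=
  ∀ (Q : Type u) [AddCommGroup Q] [Module k Q] (T : BimodStr k (Tens k A Y) Q) (ψ : N →ₗ[k] Q),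
    IsOver f S T ψ → ∃! g : N' →ₗ[k] Q,
      (∀ b x, g (S'.left b x) = T.left b (g x)) ∧ (∀ b x, g (S'.right b x) = T.right b (g x)) ∧
        g ∘ₗ φ = ψ

end

variable (k A) in
/-- A section `Λ → A-bimod_#` of the cofibration with fibre `A^{⊗ V([n])}-bimod` over `[n]`:
bimodules `M_n` with transition maps `f_! M_{n'} → M_n`, compatible with composition. -/
structure BimodSection where
  /-- the underlying cyclic vector space -/
  obj : Cyc ⥤ ModuleCat.{u} k
  bimod : ∀ X : Cyc, BimodStr k (Tens k A X) (obj.obj X)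
  isOver : ∀ {X Y : Cyc} (f : X ⟶ Y), IsOver f (bimod X) (bimod Y) (obj.map f).hom

variable (k A) in
/-- The structure of a cyclic `A`-bimodule on the `A`-bimodule `M`: a cocartesian section `M_#` of
`A-bimod_#` with `M_#([1]) ≅ M`. -/
structure CyclicBimodule (M : Type u) [AddCommGroup M] [Module k M] [Module A M]
    [Module Aᵐᵒᵖ M] extends BimodSection k A where
  isCocartesian : ∀ {X Y : Cyc} (f : X ⟶ Y), IsCocartesian f (bimod X) (bimod Y) (obj.map f).hom
  e : M ≃ₗ[k] obj.obj Cyc.one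
  e_smul : ∀ (a : A) (m : M), e (a • m) = (bimod Cyc.one).leftAt 0 a (e m)
  e_op_smul : ∀ (a : A) (m : M),
    e (MulOpposite.op a • m) = (bimod Cyc.one).rightAt 0 a (e m)

namespace BimodStr

variable {N : Type u} [AddCommGroup N] [Module k N] {X : Cyc} (S : BimodStr k (Tens k A X) N)

theorem leftAt_tprod (v : ZMod X.n) (a : A) (b : ZMod X.n → A) (x : N) :
    S.leftAt v a (S.left (PiTensorProduct.tprod k b) x) =
      S.left (PiTensorProduct.tprod k (Function.update b v (a * b v))) x := by
  rw [leftAt, ← Module.End.mul_apply, ← map_mul]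
  congr 2
  rw [PiTensorProduct.singleAlgHom_apply, PiTensorProduct.tprod_mul_tprod]
  congr 1
  funext w
  by_cases h : w = v
  · subst h; simp
  · simp [h]

theorem tprod_leftAt (v : ZMod X.n) (a : A) (b : ZMod X.n → A) (x : N) :
    S.left (PiTensorProduct.tprod k b) (S.leftAt v a x) =
      S.left (PiTensorProduct.tprod k (Function.update b v (b v * a))) x := by
  rw [leftAt, ← Module.End.mul_apply, ← map_mul]
  congr 2
  rw [PiTensorProduct.singleAlgHom_apply, PiTensorProduct.tprod_mul_tprod]
  congr 1
  funext w
  by_cases h : w = v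
  · subst h; simp
  · simp [h]

theorem left_rightAt (v : ZMod X.n) (a : A) (b : Tens k A X) (x : N) :
    S.left b (S.rightAt v a x) = S.rightAt v a (S.left b x) := S.comm _ _ _

end BimodStr

namespace CyclicBimodule

variable {M : Type u} [AddCommGroup M] [Module k M] [Module A M] [Module Aᵐᵒᵖ M]
  [SMulCommClass A Aᵐᵒᵖ M] [IsScalarTower k A M] [IsScalarTower k Aᵐᵒᵖ M]
  (C : CyclicBimodule k A M)

/-- The map `M = M_#([1]) → M_#([n])` given by the map `[1] → [n]` with image `v`. -/
noncomputable def atPoint {X : Cyc} (v : ZMod X.n) : M →ₗ[k] C.obj.obj X :=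
  (C.obj.map (Cyc.point v)).hom ∘ₗ C.e.toLinearMap

variable (k) in
/-- The map `⨂_{w ≠ v} A → ⨂_w A` inserting `1` at the place `v`. -/
noncomputable def insertOne {X : Cyc} (v : ZMod X.n) :
    (⨂[k] _ : {w : ZMod X.n // w ≠ v}, A) →ₗ[k] Tens k A X :=
  PiTensorProduct.lift (MultilinearMap.mk'
    (fun b => PiTensorProduct.tprod k (fun w => if h : w = v then 1 else b ⟨w, h⟩))
    (fun b w x y => by
      have h : ∀ z : A, (fun u => if h : u = v then (1 : A) else Function.update b w z ⟨u, h⟩) =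
          Function.update (fun u => if h : u = v then 1 else b ⟨u, h⟩) w.1 z := by
        intro z; funext u
        by_cases hu : u = w.1
        · subst hu; simp [w.2]
        · rw [Function.update_of_ne hu]
          split_ifs with hv
          · rfl
          · rw [Function.update_of_ne (fun h => hu (congrArg Subtype.val h))]
      rw [h, h, h, MultilinearMap.map_update_add])
    (fun b w c x => by
      have h : ∀ z : A, (fun u => if h : u = v then (1 : A) else Function.update b w z ⟨u, h⟩) =
          Function.update (fun u => if h : u = v then 1 else b ⟨u, h⟩) w.1 z := by
        intro z; funext u
        by_cases hu : u = w.1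
        · subst hu; simp [w.2]
        · rw [Function.update_of_ne hu]
          split_ifs with hv
          · rfl
          · rw [Function.update_of_ne (fun h => hu (congrArg Subtype.val h))]
      rw [h, h, MultilinearMap.map_update_smul]))

theorem insertOne_tprod {X : Cyc} (v : ZMod X.n) (b : {w : ZMod X.n // w ≠ v} → A) :
    insertOne k v (PiTensorProduct.tprod k b) =
      PiTensorProduct.tprod k (fun w => if h : w = v then 1 else b ⟨w, h⟩) := by
  simp [insertOne, MultilinearMap.mk']

/-- The map `M^Δ_#(⟨[n], v⟩) → M_#([n])`: the transition map of `M_#` along `v : [1] → [n]`,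
extended by the action of the factors `A` at the points different from `v`. -/
noncomputable def tauAux (P : PtCyc) : MTens k M A P →ₗ[k] C.obj.obj P.base :=
  TensorProduct.lift (LinearMap.mk₂ k
    (fun m b => (C.bimod P.base).left (insertOne k P.v b) (C.atPoint P.v m))
    (fun m m' b => by simp) (fun c m b => by simp) (fun m b b' => by simp)
    (fun c m b => by simp))

/-- The family of elements of `A` with `1` at `v` obtained from a mixed family. -/
def ext1 {n : ℕ} (v : ZMod n) (c : ZMod n → TrivSqZeroExt A M) : ZMod n → A :=
  Function.update (fun w => (c w).fst) v 1

theorem tauAux_mixedProj (P : PtCyc) (c : ZMod P.base.n → TrivSqZeroExt A M) :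
    C.tauAux P (mixedProj k P (PiTensorProduct.tprod k c)) =
      (C.bimod P.base).left (PiTensorProduct.tprod k (ext1 P.v c))
        (C.atPoint P.v (c P.v).snd) := by
  rw [mixedProj_tprod, tauAux, TensorProduct.lift.tmul, LinearMap.mk₂_apply, insertOne_tprod]
  congr 3
  funext w
  by_cases h : w = P.v
  · subst h; simp [ext1]
  · simp [ext1, h]

/-- Shorthand for the value of `tauAux` on a mixed family. -/
noncomputable def theta {X : Cyc} (v : ZMod X.n) (c : ZMod X.n → TrivSqZeroExt A M) :
    C.obj.obj X :=
  (C.bimod X).left (PiTensorProduct.tprod k (ext1 v c)) (C.atPoint v (c v).snd)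

section

variable {X Y : Cyc}

theorem lift_point (v : ZMod X.n) (i : ℤ) :
    Cyc.lift (Cyc.point v) i = v.val + i * X.n := by
  have h : ((v.val : ℕ) : ℤ) / (X.n : ℤ) = 0 :=
    Int.ediv_eq_zero_of_lt (by positivity) (by exact_mod_cast ZMod.val_lt v)
  rw [Cyc.point, Cyc.lift_mkHom]
  simp only [CycLift.normalize, CycLift.turn, zero_mul, add_zero]
  rw [h]
  simp

theorem atPoint_op_smul (v : ZMod X.n) (a : A) (m : M) :
    C.atPoint v (MulOpposite.op a • m) = (C.bimod X).rightAt v a (C.atPoint v m) := by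
  have h := (C.isOver (Cyc.point v)).map_right 0 a (C.e m)
    (by simp only [lift_point]; have := X.pos; push_cast; omega)
  simp only [lift_point] at h
  simp only [atPoint, LinearMap.comp_apply, LinearEquiv.coe_coe, C.e_op_smul]
  simpa using h

theorem atPoint_smul (v : ZMod X.n) (a : A) (m : M) :
    C.atPoint v (a • m) = (C.bimod X).leftAt v a (C.atPoint v m) := by
  have h := (C.isOver (Cyc.point v)).map_left (-1) a (C.e m)
    (by simp only [lift_point]; have := X.pos; push_cast; omega)
  simp only [lift_point] at h
  simp only [atPoint, LinearMap.comp_apply, LinearEquiv.coe_coe, C.e_smul]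
  simpa using h

theorem atPoint_central {v w : ZMod X.n} (h : w ≠ v) (a : A) (m : M) :
    (C.bimod X).leftAt w a (C.atPoint v m) = (C.bimod X).rightAt w a (C.atPoint v m) := by
  have hw : ∃ j : ℤ, (j : ZMod X.n) = w ∧ (v.val : ℤ) < j ∧ j < v.val + X.n := by
    have h1 := ZMod.val_lt v
    have h2 := ZMod.val_lt w
    have h3 : v.val ≠ w.val := fun h' => h (ZMod.val_injective _ h').symm
    rcases lt_or_gt_of_ne h3 with hlt | hlt
    · exact ⟨w.val, by simp, by omega, by omega⟩
    · exact ⟨w.val + X.n, by simp, by omega, by omega⟩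
  obtain ⟨j, rfl, h1, h2⟩ := hw
  exact (C.isOver (Cyc.point v)).unit 0 j a (C.e m) (by simpa [lift_point] using h1)
    (by simpa [lift_point] using h2)

theorem map_atPoint (f : X ⟶ Y) (v : ZMod X.n) (m : M) :
    (C.obj.map f).hom (C.atPoint v m) = C.atPoint (Cyc.pt f v) m := by
  simp only [atPoint, ← Cyc.point_comp, C.obj.map_comp]
  rfl

theorem ext1_update_of_ne {n : ℕ} {v w : ZMod n} (h : w ≠ v) (c : ZMod n → TrivSqZeroExt A M)
    (x : TrivSqZeroExt A M) :
    ext1 v (Function.update c w x) = Function.update (ext1 v c) w x.fst := by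
  funext u
  by_cases hu : u = v
  · subst hu; simp [ext1, h.symm]
  · by_cases huw : u = w
    · subst huw; simp [ext1, h]
    · simp [ext1, hu, huw]

theorem ext1_update_self {n : ℕ} (v : ZMod n) (c : ZMod n → TrivSqZeroExt A M)
    (x : TrivSqZeroExt A M) : ext1 v (Function.update c v x) = ext1 v c := by
  funext u
  by_cases hu : u = v
  · subst hu; simp [ext1]
  · simp [ext1, hu]

theorem leftAt_theta (v w : ZMod X.n) (c : ZMod X.n → TrivSqZeroExt A M) (a : A) :
    (C.bimod X).leftAt w a (C.theta v c) =
      C.theta v (Function.update c w (TrivSqZeroExt.inl a * c w)) := by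
  rw [theta, theta]
  by_cases h : w = v
  · subst h
    rw [ext1_update_self, BimodStr.leftAt_tprod, Function.update_self, TrivSqZeroExt.snd_mul]
    simp only [TrivSqZeroExt.fst_inl, TrivSqZeroExt.snd_inl, smul_zero, add_zero]
    rw [atPoint_smul, BimodStr.tprod_leftAt]
    simp [ext1]
  · rw [ext1_update_of_ne h, BimodStr.leftAt_tprod, Function.update_of_ne (Ne.symm h)]
    simp [ext1, h]

theorem rightAt_theta (v w : ZMod X.n) (c : ZMod X.n → TrivSqZeroExt A M) (a : A) :
    (C.bimod X).rightAt w a (C.theta v c) =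
      C.theta v (Function.update c w (c w * TrivSqZeroExt.inl a)) := by
  rw [theta, theta, ← BimodStr.left_rightAt]
  by_cases h : w = v
  · subst h
    rw [ext1_update_self, Function.update_self, TrivSqZeroExt.snd_mul]
    simp only [TrivSqZeroExt.fst_inl, TrivSqZeroExt.snd_inl, smul_zero, zero_add]
    rw [atPoint_op_smul]
  · rw [ext1_update_of_ne h, ← C.atPoint_central h, BimodStr.tprod_leftAt,
      Function.update_of_ne (Ne.symm h)]
    simp [ext1, h]

theorem push_merge {B : Type*} [Monoid B] (f : X ⟶ Y) (i : ℤ) (c : ZMod X.n → B)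
    (h : Cyc.lift f i = Cyc.lift f (i + 1)) :
    Cyc.push f (Function.update (Function.update c ((i + 1 : ℤ) : ZMod X.n) 1) (i : ZMod X.n)
      (c i * c ((i + 1 : ℤ) : ZMod X.n))) = Cyc.push f c := by
  have hne : (i : ZMod X.n) ≠ ((i + 1 : ℤ) : ZMod X.n) := fun he => by
    have := (Cyc.lift f).eq_of_fibre he h
    omega
  have hpt : Cyc.pt f i = Cyc.pt f ((i + 1 : ℤ) : ZMod X.n) := by
    rw [Cyc.pt_intCast, Cyc.pt_intCast, h]
  have hlo := ((Cyc.lift f).mem_fibre _ (i + 1)).2 h.symm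
  have hpost : ∀ b : ZMod X.n → B,
      Cyc.post f b i = b ((i + 1 : ℤ) : ZMod X.n) * Cyc.post f b (i + 1) := by
    intro b
    rw [Cyc.post, iprod_split _ le_rfl hlo.2, iprod_self, one_mul, Cyc.post, ← h]
    rfl
  rw [Cyc.push_update]
  funext w
  by_cases hw : w = Cyc.pt f i
  · subst hw
    rw [Function.update_self, Cyc.push_split, hpost, hpost, Function.update_self, one_mul,
      Cyc.post_congr f (i + 1) (b' := c) (fun u hu => Function.update_of_ne hu _ _)]
    have : Cyc.pre f (Function.update c ((i + 1 : ℤ) : ZMod X.n) 1) i = Cyc.pre f c i := by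
      refine iprod_congr fun l h1 h2 => Function.update_of_ne (fun he => ?_) _ _
      have h3 := ((Cyc.lift f).mem_fibre _ l).1 ⟨h1, h2.trans (((Cyc.lift f).mem_fibre _ i).2 rfl).2⟩
      have := (Cyc.lift f).eq_of_fibre he (h3.trans h)
      omega
    rw [this]
    simp only [mul_assoc]
  · rw [Function.update_of_ne hw, Cyc.push_update_of_ne _ _ _ _ (hpt ▸ hw)]

theorem isMixed_update {n : ℕ} {v w : ZMod n} {c : ZMod n → TrivSqZeroExt A M}
    (hc : IsMixed v c) (x : TrivSqZeroExt A M) (h1 : w = v → x.fst = 0)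
    (h2 : w ≠ v → x.snd = 0) : IsMixed v (Function.update c w x) := by
  constructor
  · by_cases h : v = w
    · subst h; simpa using h1 rfl
    · rw [Function.update_of_ne h]; exact hc.1
  · intro u hu
    by_cases h : u = w
    · subst h; simpa using h2 hu
    · rw [Function.update_of_ne h]; exact hc.2 u hu

theorem map_theta_aux (f : X ⟶ Y) (i₀ : ℤ) (t : ℕ) :
    ∀ c : ZMod X.n → TrivSqZeroExt A M, IsMixed (i₀ : ZMod X.n) c →
      (∀ s : ℕ, t < s → s < X.n → c ((i₀ + s : ℤ) : ZMod X.n) = 1) →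
      (C.obj.map f).hom (C.theta (i₀ : ZMod X.n) c) =
        C.theta (Cyc.pt f i₀) (Cyc.push f c) := by
  have hdist : ∀ s s' : ℕ, s < X.n → s' < X.n →
      ((i₀ + s : ℤ) : ZMod X.n) = ((i₀ + s' : ℤ) : ZMod X.n) → s = s' := by
    intro s s' hs hs' h
    push_cast at h
    have h' := add_left_cancel h
    have := congrArg ZMod.val h'
    rwa [ZMod.val_natCast_of_lt hs, ZMod.val_natCast_of_lt hs'] at this
  induction t with
  | zero =>
    intro c hc h1
    have hone : ∀ w, w ≠ (i₀ : ZMod X.n) → c w = 1 := by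
      intro w hw
      have hs : ((i₀ + ((w - i₀).val : ℕ) : ℤ) : ZMod X.n) = w := by simp
      rw [← hs]
      refine h1 _ (Nat.pos_of_ne_zero fun h0 => hw ?_) (ZMod.val_lt _)
      rw [ZMod.val_eq_zero, sub_eq_zero] at h0
      exact h0
    have hc1 : c = Function.update (fun _ => 1) (i₀ : ZMod X.n) (c i₀) := by
      funext w
      by_cases hw : w = (i₀ : ZMod X.n)
      · subst hw; simp
      · rw [Function.update_of_ne hw, hone w hw]
    have hp1 : ∀ x y, iprod (Cyc.per (fun _ : ZMod X.n => (1 : TrivSqZeroExt A M))) x y = 1 := by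
      intro x y; simp [iprod, Cyc.per]
    have hpush : Cyc.push f c = Function.update (fun _ => 1) (Cyc.pt f i₀) (c i₀) := by
      rw [hc1, Cyc.push_update, Cyc.pre, Cyc.post, hp1, hp1, one_mul, mul_one,
        Function.update_self]
      congr 1
      funext w
      exact hp1 _ _
    have hext : ∀ {n : ℕ} (v : ZMod n) (x : TrivSqZeroExt A M),
        ext1 v (Function.update (fun _ : ZMod n => (1 : TrivSqZeroExt A M)) v x) = 1 := by
      intro n v x
      rw [ext1_update_self]
      funext w
      by_cases hw : w = v
      · subst hw; simp [ext1]
      · simp [ext1, hw]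
    have hleft : ∀ {Z : Cyc} (x : C.obj.obj Z),
        (C.bimod Z).left (PiTensorProduct.tprod k (1 : ZMod Z.n → A)) x = x := by
      intro Z x
      rw [← PiTensorProduct.one_def, map_one]; rfl
    rw [hpush, theta, theta, hext, hleft, Function.update_self]
    rw [show ext1 (i₀ : ZMod X.n) c = 1 by rw [hc1, hext], hleft, map_atPoint]
  | succ t ih =>
    intro c hc h1
    by_cases ht : X.n ≤ t + 1
    · exact ih c hc fun s hs hs' => by omega
    · rw [not_le] at ht
      set j : ℤ := i₀ + t with hj
      have hjne : ((j + 1 : ℤ) : ZMod X.n) ≠ (i₀ : ZMod X.n) := by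
        intro h
        have := hdist (t + 1) 0 ht X.pos (by push_cast; push_cast [hj] at h; rw [← add_assoc, h]; simp)
        omega
      obtain ⟨a, ha⟩ : ∃ a : A, c ((j + 1 : ℤ) : ZMod X.n) = TrivSqZeroExt.inl a :=
        ⟨_, TrivSqZeroExt.ext rfl (by rw [hc.2 _ hjne]; rfl)⟩
      obtain ⟨c', hc'⟩ : ∃ c', c' = Function.update c ((j + 1 : ℤ) : ZMod X.n) 1 := ⟨_, rfl⟩
      have hcc' : c = Function.update c' ((j + 1 : ℤ) : ZMod X.n)
          (TrivSqZeroExt.inl a * c' ((j + 1 : ℤ) : ZMod X.n)) := by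
        rw [hc']; simp [← ha]
      have hmix' : IsMixed (i₀ : ZMod X.n) c' := hc' ▸ isMixed_update hc _ (fun h => absurd h hjne) (fun _ => by simp)
      have hsupp : ∀ s : ℕ, t < s → s < X.n → c' ((i₀ + s : ℤ) : ZMod X.n) = 1 := by
        intro s hs hs'
        by_cases hst : s = t + 1
        · subst hst
          have : i₀ + ((t + 1 : ℕ) : ℤ) = j + 1 := by push_cast [hj]; ring
          rw [this, hc', Function.update_self]
        · rw [hc', Function.update_of_ne, h1 s (by omega) hs']
          intro h
          refine hst (hdist s (t + 1) hs' ht ?_)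
          rw [h]; push_cast [hj]; ring
      have htheta : C.theta (i₀ : ZMod X.n) c =
          (C.bimod X).leftAt ((j + 1 : ℤ) : ZMod X.n) a (C.theta (i₀ : ZMod X.n) c') := by
        rw [leftAt_theta, ← hcc']
      rcases ((Cyc.lift f).mono (show j ≤ j + 1 by omega)).eq_or_lt with he | hlt
      · have hcj : c' (j : ZMod X.n) = c j := by
          rw [hc', Function.update_of_ne]
          intro h
          have := (Cyc.lift f).eq_of_fibre h he
          omega
        rw [htheta, (C.isOver f).balanced j a _ he, rightAt_theta, ih]
        · rw [hcj, ← ha, hc', push_merge f j c he]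
        · refine isMixed_update hmix' _ (fun h => ?_) (fun h => ?_)
          · rw [h, TrivSqZeroExt.fst_mul, hmix'.1, zero_mul]
          · rw [TrivSqZeroExt.snd_mul, hmix'.2 _ h]; simp
        · intro s hs hs'
          rw [Function.update_of_ne, hsupp s hs hs']
          intro h
          have := hdist s t hs' (by omega) h
          omega
      · have hlo : (Cyc.lift f).lo (Cyc.lift f (j + 1)) = j + 1 :=
          CycLift.lo_eq _ fun i => ⟨fun h => by
            by_contra hi
            have := (Cyc.lift f).mono (show i ≤ j by omega)
            omega, fun h => (Cyc.lift f).mono h⟩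
        have hpre : Cyc.pre f c' (j + 1) = 1 := by rw [Cyc.pre, hlo, iprod_self]
        rw [htheta, (C.isOver f).map_left j a _ hlt]
        have := ih c' hmix' hsupp
        rw [this, leftAt_theta]
        congr 1
        conv_rhs => rw [hcc']
        rw [Cyc.push_update, hpre, ← Cyc.pt_intCast, Cyc.push_split, hpre]
        simp only [one_mul, mul_assoc]

theorem map_theta (f : X ⟶ Y) (v : ZMod X.n) (c : ZMod X.n → TrivSqZeroExt A M)
    (hc : IsMixed v c) :
    (C.obj.map f).hom (C.theta v c) = C.theta (Cyc.pt f v) (Cyc.push f c) := by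
  obtain ⟨i, rfl⟩ := Cyc.exists_int v
  exact C.map_theta_aux f i X.n c hc fun s hs hs' => by omega

end

/-- The map `M^Δ_# ⟶ j^* M_#`. -/
noncomputable def tauDelta : mDelta k A M ⟶ PtCyc.j ⋙ C.obj where
  app P := ModuleCat.ofHom (C.tauAux P)
  naturality P Q f := by
    ext : 1
    refine MTens.ext k fun c hc => ?_
    have h1 := C.map_theta f.1 P.v c hc
    rw [f.2] at h1
    refine (congrArg (C.tauAux Q) (mDelta_map_mixedProj k f hc)).trans ?_
    refine (C.tauAux_mixedProj Q _).trans (h1.symm.trans ?_)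
    exact congrArg (C.obj.map f.1).hom (C.tauAux_mixedProj P c).symm

/-- The structure map `τ_# : j_! M^Δ_# ⟶ M_#`. -/
noncomputable def tau : jShriek (mDelta k A M) ⟶ C.obj := jDesc C.tauDelta

end CyclicBimodule

end Bimodules

/-! ### The extension `\widehat{A_#}` -/

section Hat

open Limits

variable {k A M E : Type u} [Field k] [Ring A] [Algebra k A]
  [AddCommGroup M] [Module k M] [Module A M] [Module Aᵐᵒᵖ M]
  [SMulCommClass A Aᵐᵒᵖ M] [IsScalarTower k A M] [IsScalarTower k Aᵐᵒᵖ M]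
  [Ring E] [Algebra k E] (S : SquareZeroExtension k A M E) (C : CyclicBimodule k A M)

/-- The cyclic vector space `\widehat{A_#}`: the pushout of `\overline{A_#}` along `τ_#`. -/
noncomputable def hat : Cyc ⥤ ModuleCat.{u} k := pushout C.tau S.barIncl

/-- The map `\overline{A_#} ⟶ \widehat{A_#}`. -/
noncomputable def barToHat : S.bar ⟶ hat S C := pushout.inr _ _

/-- The sequence `0 → M_# → \widehat{A_#} → A_# → 0`. -/
noncomputable def hatRow : ShortComplex (Cyc ⥤ ModuleCat.{u} k) :=
  ShortComplex.mk (X₁ := C.obj) (X₂ := hat S C) (X₃ := sharp k A) (pushout.inl _ _)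
    (pushout.desc 0 S.barProj (by rw [comp_zero, S.barIncl_barProj])) (pushout.inl_desc _ _ _)

end Hat

/-! ### Homology of small categories -/

section Homology

open Opposite Simplicial

variable {Γ : Type} [Category.{0} Γ] {k : Type u} [Field k]

/-- Restriction of a string of morphisms `σ 0 → ⋯ → σ n` along a map `[m] → [n]`. -/
abbrev strPull {m n : SimplexCategory} (α : m ⟶ n) (σ : ComposableArrows Γ n.len) :
    ComposableArrows Γ m.len :=
  σ.whiskerLeft α.toOrderHom.monotone.functor

/-- The space `⨁ E(σ 0)`, where the sum is over all strings `σ 0 → ⋯ → σ m` of `m` composable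
morphisms of `Γ`. -/
abbrev Str (E : Γ ⥤ ModuleCat.{u} k) (m : ℕ) : Type u :=
  ⨁ σ : ComposableArrows Γ m, E.obj (σ.obj 0)

open Classical in
/-- The inclusion of the summand corresponding to `σ`. -/
noncomputable def strIn (E : Γ ⥤ ModuleCat.{u} k) {m : ℕ} (σ : ComposableArrows Γ m) :
    E.obj (σ.obj 0) →ₗ[k] Str E m :=
  DirectSum.lof k _ (fun σ : ComposableArrows Γ m => E.obj (σ.obj 0)) σ

open Classical in
/-- The map out of the sum given by its components. -/
noncomputable def strDesc (E : Γ ⥤ ModuleCat.{u} k) {m : ℕ} {V : Type u} [AddCommGroup V]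
    [Module k V] (φ : ∀ σ : ComposableArrows Γ m, E.obj (σ.obj 0) →ₗ[k] V) : Str E m →ₗ[k] V :=
  DirectSum.toModule k _ V φ

theorem strDesc_strIn (E : Γ ⥤ ModuleCat.{u} k) {m : ℕ} {V : Type u} [AddCommGroup V]
    [Module k V] (φ : ∀ σ : ComposableArrows Γ m, E.obj (σ.obj 0) →ₗ[k] V)
    (σ : ComposableArrows Γ m) (x : E.obj (σ.obj 0)) :
    strDesc E φ (strIn E σ x) = φ σ x := by
  classical
  exact DirectSum.toModule_lof (φ := φ) k σ x

theorem str_ext (E : Γ ⥤ ModuleCat.{u} k) {m : ℕ} {V : Type u} [AddCommGroup V]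
    [Module k V] {φ ψ : Str E m →ₗ[k] V}
    (h : ∀ (σ : ComposableArrows Γ m) (x : E.obj (σ.obj 0)), φ (strIn E σ x) = ψ (strIn E σ x)) :
    φ = ψ := by
  classical
  exact DirectSum.linearMap_ext k fun σ => LinearMap.ext fun x => h σ x

/-- The map `E(σ 0) → E(σ (α 0))` given by the string `σ`. -/
noncomputable def strShift (E : Γ ⥤ ModuleCat.{u} k) {m n : SimplexCategory} (α : m ⟶ n)
    (σ : ComposableArrows Γ n.len) : E.obj (σ.obj 0) →ₗ[k] E.obj ((strPull α σ).obj 0) :=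
  (E.map (σ.map (homOfLE (Fin.zero_le (α.toOrderHom 0))))).hom

theorem strShift_id (E : Γ ⥤ ModuleCat.{u} k) {m : SimplexCategory}
    (σ : ComposableArrows Γ m.len) (x : E.obj (σ.obj 0)) : strShift E (𝟙 m) σ x = x := by
  have h : E.map (σ.map (homOfLE (Fin.zero_le (0 : Fin (m.len + 1))))) = 𝟙 _ :=
    (congrArg E.map (σ.map_id 0)).trans (E.map_id _)
  exact congrArg (fun f : E.obj (σ.obj 0) ⟶ E.obj (σ.obj 0) => f.hom x) h

theorem strShift_comp (E : Γ ⥤ ModuleCat.{u} k) {l m n : SimplexCategory} (β : l ⟶ m)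
    (α : m ⟶ n) (σ : ComposableArrows Γ n.len) (x : E.obj (σ.obj 0)) :
    strShift E (β ≫ α) σ x = strShift E β (strPull α σ) (strShift E α σ x) := by
  have h : E.map (σ.map (homOfLE (Fin.zero_le ((β ≫ α).toOrderHom 0)))) =
      E.map (σ.map (homOfLE (Fin.zero_le (α.toOrderHom 0)))) ≫
      E.map (σ.map (homOfLE (α.toOrderHom.monotone (Fin.zero_le (β.toOrderHom 0))))) := by
    rw [← E.map_comp, ← σ.map_comp]
    rfl
  exact congrArg (fun f : E.obj (σ.obj 0) ⟶ E.obj (σ.obj ((β ≫ α).toOrderHom 0)) => f.hom x) h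

/-- The action on strings of a map `α : [m] → [n]`: the summand of `σ` is mapped to the summand of
the restriction of `σ` along `α`. -/
noncomputable def strMap (E : Γ ⥤ ModuleCat.{u} k) {m n : SimplexCategory} (α : m ⟶ n) :
    Str E n.len →ₗ[k] Str E m.len :=
  strDesc E fun σ => strIn E (strPull α σ) ∘ₗ strShift E α σ

theorem strMap_strIn (E : Γ ⥤ ModuleCat.{u} k) {m n : SimplexCategory} (α : m ⟶ n)
    (σ : ComposableArrows Γ n.len) (x : E.obj (σ.obj 0)) :
    strMap E α (strIn E σ x) = strIn E (strPull α σ) (strShift E α σ x) :=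
  strDesc_strIn E _ σ x

theorem strMap_id (E : Γ ⥤ ModuleCat.{u} k) (m : SimplexCategory) :
    strMap E (𝟙 m) = LinearMap.id := by
  refine str_ext E fun σ x => ?_
  rw [strMap_strIn, strShift_id]
  rfl

theorem strMap_comp (E : Γ ⥤ ModuleCat.{u} k) {l m n : SimplexCategory} (β : l ⟶ m)
    (α : m ⟶ n) : strMap E (β ≫ α) = strMap E β ∘ₗ strMap E α := by
  refine str_ext E fun σ x => ?_
  rw [LinearMap.comp_apply, strMap_strIn, strMap_strIn, strMap_strIn, strShift_comp]
  rfl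

/-- The simplicial vector space of strings with coefficients in `E`. -/
noncomputable def strings (E : Γ ⥤ ModuleCat.{u} k) : SimplicialObject (ModuleCat.{u} k) where
  obj m := ModuleCat.of k (Str E m.unop.len)
  map α := ModuleCat.ofHom (strMap E α.unop)
  map_id n := by
    ext : 1
    exact strMap_id E n.unop
  map_comp α β := by
    ext : 1
    exact strMap_comp E β.unop α.unop

/-- The functoriality of the space of strings in the coefficients. -/
noncomputable def strCoeff {E F : Γ ⥤ ModuleCat.{u} k} (φ : E ⟶ F) (m : ℕ) :
    Str E m →ₗ[k] Str F m :=
  strDesc E fun σ => strIn F σ ∘ₗ (φ.app (σ.obj 0)).hom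

theorem strCoeff_strIn {E F : Γ ⥤ ModuleCat.{u} k} (φ : E ⟶ F) {m : ℕ}
    (σ : ComposableArrows Γ m) (x : E.obj (σ.obj 0)) :
    strCoeff φ m (strIn E σ x) = strIn F σ ((φ.app (σ.obj 0)).hom x) :=
  strDesc_strIn E _ σ x

theorem strCoeff_strMap {E F : Γ ⥤ ModuleCat.{u} k} (φ : E ⟶ F) {m n : SimplexCategory}
    (α : m ⟶ n) :
    strCoeff φ m.len ∘ₗ strMap E α = strMap F α ∘ₗ strCoeff φ n.len := by
  refine str_ext E fun σ x => ?_
  rw [LinearMap.comp_apply, LinearMap.comp_apply, strMap_strIn, strCoeff_strIn, strCoeff_strIn,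
    strMap_strIn]
  exact congrArg (fun f : E.obj (σ.obj 0) ⟶ F.obj ((strPull α σ).obj 0) =>
    strIn F (strPull α σ) (f.hom x)) (φ.naturality (σ.map (homOfLE (Fin.zero_le (α.toOrderHom 0)))))

/-- The functoriality of `strings` in the coefficients. -/
noncomputable def stringsMap {E F : Γ ⥤ ModuleCat.{u} k} (φ : E ⟶ F) : strings E ⟶ strings F where
  app m := ModuleCat.ofHom (strCoeff φ m.unop.len)
  naturality n m α := by
    ext : 1
    exact strCoeff_strMap φ α.unop

theorem strCoeff_id (E : Γ ⥤ ModuleCat.{u} k) (m : ℕ) : strCoeff (𝟙 E) m = LinearMap.id := by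
  refine str_ext E fun σ x => ?_
  rw [strCoeff_strIn]
  rfl

theorem strCoeff_comp {E F G : Γ ⥤ ModuleCat.{u} k} (φ : E ⟶ F) (ψ : F ⟶ G) (m : ℕ) :
    strCoeff (φ ≫ ψ) m = strCoeff ψ m ∘ₗ strCoeff φ m := by
  refine str_ext E fun σ x => ?_
  rw [LinearMap.comp_apply, strCoeff_strIn, strCoeff_strIn, strCoeff_strIn]
  rfl

theorem strCoeff_zero (E F : Γ ⥤ ModuleCat.{u} k) (m : ℕ) :
    strCoeff (0 : E ⟶ F) m = 0 := by
  refine str_ext E fun σ x => ?_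
  rw [strCoeff_strIn]
  simp

/-- The standard complex `⨁ E(σ 0)` computing the homology `H_•(Γ, E)` of the category `Γ` with
coefficients in `E`, that is, the derived functors of the direct limit over `Γ`. -/
noncomputable def stdComplex (E : Γ ⥤ ModuleCat.{u} k) : ChainComplex (ModuleCat.{u} k) ℕ :=
  (AlgebraicTopology.alternatingFaceMapComplex (ModuleCat.{u} k)).obj (strings E)

/-- The functoriality of the standard complex in the coefficients. -/
noncomputable def stdComplexMap {E F : Γ ⥤ ModuleCat.{u} k} (φ : E ⟶ F) :
    stdComplex E ⟶ stdComplex F :=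
  (AlgebraicTopology.alternatingFaceMapComplex (ModuleCat.{u} k)).map (stringsMap φ)

theorem stdComplexMap_f {E F : Γ ⥤ ModuleCat.{u} k} (φ : E ⟶ F) (m : ℕ) :
    (stdComplexMap φ).f m = ModuleCat.ofHom (strCoeff φ m) := rfl

/-- Multiplication of the summands by a function on the set of strings. -/
noncomputable def weight (E : Γ ⥤ ModuleCat.{u} k) {m : ℕ} (c : ComposableArrows Γ m → k) :
    Str E m →ₗ[k] Str E m :=
  strDesc E fun σ => c σ • strIn E σ

theorem weight_strIn (E : Γ ⥤ ModuleCat.{u} k) {m : ℕ} (c : ComposableArrows Γ m → k)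
    (σ : ComposableArrows Γ m) (x : E.obj (σ.obj 0)) :
    weight E c (strIn E σ x) = c σ • strIn E σ x :=
  strDesc_strIn E _ σ x

theorem strCoeff_weight {E F : Γ ⥤ ModuleCat.{u} k} (φ : E ⟶ F) {m : ℕ}
    (c : ComposableArrows Γ m → k) :
    strCoeff φ m ∘ₗ weight E c = weight F c ∘ₗ strCoeff φ m := by
  refine str_ext E fun σ x => ?_
  rw [LinearMap.comp_apply, LinearMap.comp_apply, weight_strIn, map_smul, strCoeff_strIn,
    weight_strIn]

end Homology

/-! ### The periodicity map -/

section Periodicity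

open Opposite Simplicial

variable {k : Type u} [Field k]

/-- The `2`-cocycle of the central extension of `Λ` by `ℤ` whose morphisms are the lifts `CycLift`
of the morphisms of `Λ`, for the normalized lifts: `(lift g) ∘ (lift f)` differs from
`lift (f ≫ g)` by `wind f g` full turns. Its class generates `H²(Λ, k)`. -/
noncomputable def wind {X Y Z : Cyc} (f : X ⟶ Y) (g : Y ⟶ Z) : ℤ := Cyc.lift g (Cyc.lift f 0) / Z.n

theorem lift_comp_turn {X Y Z : Cyc} (f : X ⟶ Y) (g : Y ⟶ Z) :
    (Cyc.lift f).comp (Cyc.lift g) = (Cyc.lift (f ≫ g)).turn (wind f g) := by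
  rw [Cyc.lift_comp]
  ext i
  simp [CycLift.comp, CycLift.turn, CycLift.normalize, wind]

theorem wind_cocycle {X Y Z W : Cyc} (f : X ⟶ Y) (g : Y ⟶ Z) (h : Z ⟶ W) :
    wind g h + wind f (g ≫ h) = wind (f ≫ g) h + wind f g := by
  have hW : (W.n : ℤ) ≠ 0 := by exact_mod_cast W.pos.ne'
  have h1 : Cyc.lift g (Cyc.lift f 0) = Cyc.lift (f ≫ g) 0 + wind f g * Z.n :=
    congrFun (congrArg CycLift.toFun (lift_comp_turn f g)) 0
  have h2 : Cyc.lift h (Cyc.lift g (Cyc.lift f 0)) =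
      Cyc.lift (g ≫ h) (Cyc.lift f 0) + wind g h * W.n :=
    congrFun (congrArg CycLift.toFun (lift_comp_turn g h)) (Cyc.lift f 0)
  have h3 : Cyc.lift h (Cyc.lift g (Cyc.lift f 0)) / W.n = wind (f ≫ g) h + wind f g := by
    rw [h1, CycLift.per_mul, Int.add_mul_ediv_right _ _ hW]; rfl
  rw [h2, Int.add_mul_ediv_right _ _ hW] at h3
  rw [← h3, add_comm]; rfl

/-- The value of the cocycle on the morphisms `σ a → σ b → σ c` of a string. -/
noncomputable def windAt {n : ℕ} (σ : ComposableArrows Cyc n) (a b c : Fin (n + 1)) (hab : a ≤ b)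
    (hbc : b ≤ c) : ℤ := wind (σ.map (homOfLE hab)) (σ.map (homOfLE hbc))

theorem windAt_cocycle {n : ℕ} (σ : ComposableArrows Cyc n) (a b c d : Fin (n + 1)) (hab : a ≤ b)
    (hbc : b ≤ c) (hcd : c ≤ d) :
    windAt σ b c d hbc hcd + windAt σ a b d hab (hbc.trans hcd) =
      windAt σ a c d (hab.trans hbc) hcd + windAt σ a b c hab hbc := by
  have := wind_cocycle (σ.map (homOfLE hab)) (σ.map (homOfLE hbc)) (σ.map (homOfLE hcd))
  rw [← σ.map_comp, ← σ.map_comp] at this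
  exact this

/-- The inclusion of the front face `{0, …, m}` of `{0, …, m + 2}`. -/
def front (m : ℕ) : ⦋m⦌ ⟶ ⦋m + 2⦌ :=
  SimplexCategory.mkHom ⟨Fin.castLE (by omega), fun _ _ h => h⟩

/-- The coefficient of a string in the cap product. -/
noncomputable def capCoeff (k : Type u) [Field k] (m : ℕ) (σ : ComposableArrows Cyc (m + 2)) : k :=
  ((windAt σ ⟨m, by omega⟩ ⟨m + 1, by omega⟩ ⟨m + 2, by omega⟩ (by simp) (by simp) : ℤ) : k)

/-- The chain level action of the cocycle `wind` on the standard complex (cap product): the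
summand of the string `σ 0 → ⋯ → σ (m + 2)` is mapped to the summand of `σ 0 → ⋯ → σ m`,
with the coefficient given by the value of the cocycle on the last two morphisms. The map it induces
on `HC_•(E) = H_•(Λ, E)` is the periodicity map `u : HC_{m + 2}(E) → HC_m(E)`. -/
noncomputable def cap (E : Cyc ⥤ ModuleCat.{u} k) (m : ℕ) : Str E (m + 2) →ₗ[k] Str E m :=
  strMap E (front m) ∘ₗ weight E (capCoeff k m)

theorem cap_strIn (E : Cyc ⥤ ModuleCat.{u} k) (m : ℕ) (σ : ComposableArrows Cyc (m + 2))
    (x : E.obj (σ.obj 0)) :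
    cap E m (strIn E σ x) = capCoeff k m σ • strMap E (front m) (strIn E σ x) := by
  rw [cap, LinearMap.comp_apply, weight_strIn, map_smul]

theorem cap_naturality {E F : Cyc ⥤ ModuleCat.{u} k} (φ : E ⟶ F) (m : ℕ) :
    strCoeff φ m ∘ₗ cap E m = cap F m ∘ₗ strCoeff φ (m + 2) := by
  rw [cap, cap, LinearMap.comp_assoc, ← strCoeff_weight, ← LinearMap.comp_assoc,
    ← LinearMap.comp_assoc]
  exact congrArg (· ∘ₗ weight E (capCoeff k m)) (strCoeff_strMap φ (front m))

/-- The differential of the standard complex, as a linear map. -/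
noncomputable def strD (E : Cyc ⥤ ModuleCat.{u} k) (m : ℕ) : Str E (m + 1) →ₗ[k] Str E m :=
  ((stdComplex E).d (m + 1) m).hom

theorem strD_eq (E : Cyc ⥤ ModuleCat.{u} k) (m : ℕ) :
    strD E m = ∑ i : Fin (m + 2), (-1 : ℤ) ^ (i : ℕ) • strMap E (SimplexCategory.δ i) := by
  have h : (stdComplex E).d (m + 1) m =
      AlgebraicTopology.AlternatingFaceMapComplex.objD (strings E) m :=
    AlgebraicTopology.alternatingFaceMapComplex_obj_d _ _
  refine (congrArg ModuleCat.Hom.hom h).trans ?_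
  exact ModuleCat.hom_sum (R := k) (M := ModuleCat.of k (Str E (m + 1)))
    (N := ModuleCat.of k (Str E m)) (fun i : Fin (m + 2) => (-1 : ℤ) ^ (i : ℕ) •
      ModuleCat.ofHom (strMap E (SimplexCategory.δ i))) Finset.univ

theorem strD_comp (E : Cyc ⥤ ModuleCat.{u} k) (m : ℕ) : strD E m ∘ₗ strD E (m + 1) = 0 :=
  congrArg ModuleCat.Hom.hom ((stdComplex E).d_comp_d (m + 2) (m + 1) m)

theorem strCoeff_strD {E F : Cyc ⥤ ModuleCat.{u} k} (φ : E ⟶ F) (m : ℕ) :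
    strCoeff φ m ∘ₗ strD E m = strD F m ∘ₗ strCoeff φ (m + 1) :=
  (congrArg ModuleCat.Hom.hom ((stdComplexMap φ).comm (m + 1) m)).symm

theorem δ_val {n : ℕ} (i : Fin (n + 2)) (j : Fin (n + 1)) :
    (((SimplexCategory.δ i).toOrderHom j : Fin (n + 2)) : ℕ) =
      if (j : ℕ) < i then (j : ℕ) else j + 1 := by
  change ((i.succAbove j : Fin (n + 2)) : ℕ) = _
  rw [Fin.succAbove]
  split_ifs with h1 h2 h2
  · rfl
  · exact absurd h1 h2
  · exact absurd h2 h1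
  · rfl

/-- The value of the coefficient on a restriction of a string. -/
theorem capCoeff_pull {n : ℕ} (m : ℕ) (α : ⦋m + 2⦌ ⟶ ⦋n⦌)
    (σ : ComposableArrows Cyc n) (a b c : Fin (n + 1)) (hab : a ≤ b) (hbc : b ≤ c)
    (ha : α.toOrderHom (⟨m, by simp⟩ : Fin (m + 2 + 1)) = a)
    (hb : α.toOrderHom (⟨m + 1, by simp⟩ : Fin (m + 2 + 1)) = b)
    (hc : α.toOrderHom (⟨m + 2, by simp⟩ : Fin (m + 2 + 1)) = c) :
    capCoeff k m (strPull α σ) = ((windAt σ a b c hab hbc : ℤ) : k) := by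
  subst ha hb hc
  rfl

theorem hom_ext_val {m n : ℕ} {f g : ⦋m⦌ ⟶ ⦋n⦌}
    (h : ∀ j : Fin (m + 1), ((f.toOrderHom j : Fin (n + 1)) : ℕ) = (g.toOrderHom j : Fin (n + 1))) :
    f = g :=
  SimplexCategory.Hom.ext _ _ (OrderHom.ext _ _ (funext fun j => Fin.ext (h j)))

theorem front_δ {m : ℕ} (i : Fin (m + 4)) (h : m < (i : ℕ)) (j : Fin (m + 1)) :
    (((front m ≫ SimplexCategory.δ i).toOrderHom j : Fin (m + 4)) : ℕ) = j := by
  refine (δ_val i (Fin.castLE (by omega) j)).trans (if_pos ?_)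
  change (j : ℕ) < i
  omega

theorem δ_last_front {m : ℕ} (j : Fin (m + 1)) :
    (((SimplexCategory.δ (Fin.last (m + 1)) ≫ front (m + 1)).toOrderHom j : Fin (m + 4)) : ℕ) =
      j := by
  refine (δ_val (Fin.last (m + 1)) j).trans (if_pos ?_)
  rw [Fin.val_last]
  omega

theorem front_δ_eq {m : ℕ} (i : Fin (m + 4)) (h : m < (i : ℕ)) :
    front m ≫ SimplexCategory.δ i = SimplexCategory.δ (Fin.last (m + 1)) ≫ front (m + 1) :=
  hom_ext_val fun j => (front_δ i h j).trans (δ_last_front j).symm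

theorem δ_front {m : ℕ} (i : Fin (m + 1)) :
    front m ≫ SimplexCategory.δ i.castSucc.castSucc.castSucc =
      SimplexCategory.δ i.castSucc ≫ front (m + 1) :=
  hom_ext_val fun j => (δ_val i.castSucc.castSucc.castSucc (Fin.castLE (by omega) j)).trans
    (δ_val i.castSucc j).symm

theorem cap_comm (E : Cyc ⥤ ModuleCat.{u} k) (m : ℕ) :
    cap E m ∘ₗ strD E (m + 2) = strD E m ∘ₗ cap E (m + 1) := by
  refine str_ext E fun σ x => ?_
  have key : ∀ i : Fin (m + 4), cap E m (strMap E (SimplexCategory.δ i) (strIn E σ x)) =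
      capCoeff k m (strPull (SimplexCategory.δ i) σ) •
        strMap E (front m ≫ SimplexCategory.δ i) (strIn E σ x) := by
    intro i
    rw [strMap_strIn, strMap_comp, LinearMap.comp_apply, strMap_strIn]
    exact cap_strIn E m (strPull (SimplexCategory.δ i) σ) _
  have key2 : ∀ i : Fin (m + 2), strMap E (SimplexCategory.δ i) (cap E (m + 1) (strIn E σ x)) =
      capCoeff k (m + 1) σ • strMap E (SimplexCategory.δ i ≫ front (m + 1)) (strIn E σ x) := by
    intro i
    rw [cap_strIn, map_smul, strMap_comp, LinearMap.comp_apply]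
  rw [LinearMap.comp_apply, LinearMap.comp_apply, strD_eq, strD_eq]
  simp only [LinearMap.sum_apply, LinearMap.smul_apply, map_sum, map_zsmul, key, key2]
  rw [Fin.sum_univ_castSucc, Fin.sum_univ_castSucc, Fin.sum_univ_castSucc (n := m + 1),
    Fin.sum_univ_castSucc (n := m + 1), add_assoc, add_assoc]
  rw [front_δ_eq (Fin.last (m + 1)).castSucc.castSucc (by simp),
    front_δ_eq (Fin.last (m + 2)).castSucc (by simp), front_δ_eq (Fin.last (m + 3)) (by simp)]
  have c0 : ∀ i : Fin (m + 1),
      capCoeff k m (strPull (SimplexCategory.δ i.castSucc.castSucc.castSucc) σ) =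
        capCoeff k (m + 1) σ := by
    intro i
    refine capCoeff_pull m _ σ ⟨m + 1, by omega⟩ ⟨m + 2, by omega⟩ ⟨m + 3, by omega⟩
      (by simp) (by simp) ?_ ?_ ?_
    all_goals exact Fin.ext ((δ_val _ _).trans (if_neg (by simp <;> omega)))
  have c1 := capCoeff_pull (k := k) m (SimplexCategory.δ (Fin.last (m + 1)).castSucc.castSucc) σ
    ⟨m, by omega⟩ ⟨m + 2, by omega⟩ ⟨m + 3, by omega⟩ (by simp) (by simp)
    (Fin.ext ((δ_val _ _).trans (if_pos (by simp))))
    (Fin.ext ((δ_val _ _).trans (if_neg (by simp))))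
    (Fin.ext ((δ_val _ _).trans (if_neg (by simp))))
  have c2 := capCoeff_pull (k := k) m (SimplexCategory.δ (Fin.last (m + 2)).castSucc) σ
    ⟨m, by omega⟩ ⟨m + 1, by omega⟩ ⟨m + 3, by omega⟩ (by simp) (by simp)
    (Fin.ext ((δ_val _ _).trans (if_pos (by simp))))
    (Fin.ext ((δ_val _ _).trans (if_pos (by simp))))
    (Fin.ext ((δ_val _ _).trans (if_neg (by simp))))
  have c3 := capCoeff_pull (k := k) m (SimplexCategory.δ (Fin.last (m + 3))) σ
    ⟨m, by omega⟩ ⟨m + 1, by omega⟩ ⟨m + 2, by omega⟩ (by simp) (by simp)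
    (Fin.ext ((δ_val _ _).trans (if_pos (by simp))))
    (Fin.ext ((δ_val _ _).trans (if_pos (by simp))))
    (Fin.ext ((δ_val _ _).trans (if_pos (by simp))))
  have hc := windAt_cocycle σ ⟨m, by omega⟩ ⟨m + 1, by omega⟩ ⟨m + 2, by omega⟩ ⟨m + 3, by omega⟩
    (by simp) (by simp) (by simp)
  have h4 : capCoeff k (m + 1) σ = capCoeff k m (strPull (SimplexCategory.δ (Fin.last (m + 1)).castSucc.castSucc) σ)
      - capCoeff k m (strPull (SimplexCategory.δ (Fin.last (m + 2)).castSucc) σ)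
      + capCoeff k m (strPull (SimplexCategory.δ (Fin.last (m + 3))) σ) := by
    rw [c1, c2, c3]
    have := congrArg (Int.cast (R := k)) hc
    push_cast at this
    rw [sub_add_eq_add_sub, eq_sub_iff_add_eq]
    exact this
  congr 1
  · refine Finset.sum_congr rfl fun i _ => ?_
    rw [c0, δ_front]
    rfl
  · rw [h4]
    simp only [Fin.val_castSucc, Fin.val_last, pow_succ, add_smul, sub_smul, smul_add, smul_sub]
    simp only [mul_neg, mul_one, neg_neg, neg_smul]
    abel

end Periodicity

/-! ### Periodic cyclic homology -/

section HP

variable {k : Type u} [Field k] (E : Cyc ⥤ ModuleCat.{u} k)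

/-- The degrees `m ≥ 0` of the form `i + 2 N`, with `N : ℤ`. -/
abbrev TowerIdx (i : ℤ) : Type := {m : ℕ // ∃ N : ℤ, (m : ℤ) = i + 2 * N}

/-- The degree `m + 1`, for `m` of the form `i + 2 N`. -/
def TowerIdx.succ {i : ℤ} (m : TowerIdx i) : TowerIdx (i + 1) :=
  ⟨m.1 + 1, by obtain ⟨N, hN⟩ := m.2; exact ⟨N, by push_cast; linarith⟩⟩

/-- The degree `m + 2`, for `m` of the form `i + 2 N`. -/
def TowerIdx.add2 {i : ℤ} (m : TowerIdx i) : TowerIdx i :=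
  ⟨m.1 + 2, by obtain ⟨N, hN⟩ := m.2; exact ⟨N + 1, by push_cast; linarith⟩⟩

/-- The degree `i` term of the product over `N : ℤ` of the shifts `C[2N]`, with
`C[2N]_i = C_{i + 2 N}`, of the standard complex `C` of `E`. -/
abbrev Tower (i : ℤ) : Type u := ∀ m : TowerIdx i, Str E m.1

/-- The differential of the product of the complexes `C[2N]`. -/
noncomputable def towerD (i : ℤ) : Tower E (i + 1) →ₗ[k] Tower E i :=
  LinearMap.pi fun m => strD E m.1 ∘ₗ LinearMap.proj m.succ

/-- The endomorphism of the product of the complexes `C[2N]` given by the periodicity maps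
`C[2N + 2] → C[2N]`. -/
noncomputable def towerU (i : ℤ) : Tower E i →ₗ[k] Tower E i :=
  LinearMap.pi fun m => cap E m.1 ∘ₗ LinearMap.proj m.add2

variable {E} in
/-- The functoriality of the product of the complexes `C[2N]` in the coefficients. -/
noncomputable def towerMap {F : Cyc ⥤ ModuleCat.{u} k} (φ : E ⟶ F) (i : ℤ) :
    Tower E i →ₗ[k] Tower F i :=
  LinearMap.pi fun m => strCoeff φ m.1 ∘ₗ LinearMap.proj m

theorem towerD_towerD (i : ℤ) (x : Tower E (i + 1 + 1)) :
    towerD E i (towerD E (i + 1) x) = 0 :=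
  funext fun m => LinearMap.congr_fun (strD_comp E m.1) (x m.succ.succ)

theorem towerD_towerU (i : ℤ) (x : Tower E (i + 1)) :
    towerD E i (towerU E (i + 1) x) = towerU E i (towerD E i x) :=
  funext fun m => (LinearMap.congr_fun (cap_comm E m.1) (x m.add2.succ)).symm

theorem towerMap_towerD {F : Cyc ⥤ ModuleCat.{u} k} (φ : E ⟶ F) (i : ℤ) (x : Tower E (i + 1)) :
    towerMap φ i (towerD E i x) = towerD F i (towerMap φ (i + 1) x) :=
  funext fun m => LinearMap.congr_fun (strCoeff_strD φ m.1) (x m.succ)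

theorem towerMap_towerU {F : Cyc ⥤ ModuleCat.{u} k} (φ : E ⟶ F) (i : ℤ) (x : Tower E i) :
    towerMap φ i (towerU E i x) = towerU F i (towerMap φ i x) :=
  funext fun m => LinearMap.congr_fun (cap_naturality φ m.1) (x m.add2)

/-- The differential of the fibre (shifted cone) of `1 - u`. -/
noncomputable def hpD (i : ℤ) :
    (Tower E (i + 1) × Tower E (i + 1 + 1)) →ₗ[k] (Tower E i × Tower E (i + 1)) :=
  LinearMap.prod (towerD E i ∘ₗ LinearMap.fst k _ _)
    ((LinearMap.id - towerU E (i + 1)) ∘ₗ LinearMap.fst k _ _ -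
      towerD E (i + 1) ∘ₗ LinearMap.snd k _ _)

theorem hpD_hpD (i : ℤ) : hpD E i ∘ₗ hpD E (i + 1) = 0 := by
  refine LinearMap.ext fun x => Prod.ext (towerD_towerD E i x.1) ?_
  change (towerD E (i + 1) x.1 - towerU E (i + 1) (towerD E (i + 1) x.1)) -
    towerD E (i + 1) (x.1 - towerU E (i + 1 + 1) x.1 - towerD E (i + 1 + 1) x.2) = 0
  rw [map_sub, map_sub, towerD_towerD, towerD_towerU]
  abel

variable (k) in
/-- The complex computing periodic cyclic homology: the derived inverse limit of the tower of the
complexes `C[2N]` and of the periodicity maps `u : C[2N + 2] → C[2N]`, where `C` is the standard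
complex computing `HC_•(E) = H_•(Λ, E)`. The derived inverse limit is the fibre of `1 - u` on the
product of the terms of the tower. -/
noncomputable def HPComplex : (Cyc ⥤ ModuleCat.{u} k) ⥤ ChainComplex (ModuleCat.{u} k) ℤ where
  obj E := ChainComplex.of (fun i => ModuleCat.of k (Tower E i × Tower E (i + 1)))
    (fun i => ModuleCat.ofHom (hpD E i)) (fun i => by
      ext : 1
      exact hpD_hpD E i)
  map {E F} φ := ChainComplex.ofHom
    (fun i => ModuleCat.ofHom (LinearMap.prodMap (towerMap φ i) (towerMap φ (i + 1))))
    (fun i => by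
      dsimp only
      rw [ChainComplex.of_d, ChainComplex.of_d]
      ext : 1
      refine LinearMap.ext fun x => Prod.ext (towerMap_towerD E φ i x.1).symm ?_
      change towerMap φ (i + 1) x.1 - towerU F (i + 1) (towerMap φ (i + 1) x.1) -
        towerD F (i + 1) (towerMap φ (i + 1 + 1) x.2) =
          towerMap φ (i + 1) (x.1 - towerU E (i + 1) x.1 - towerD E (i + 1) x.2)
      rw [map_sub, map_sub, towerMap_towerD, towerMap_towerU])
  map_id E := by
    ext i : 2
    refine LinearMap.ext fun x => Prod.ext (funext fun m => ?_) (funext fun m => ?_)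
    · exact LinearMap.congr_fun (strCoeff_id E m.1) (x.1 m)
    · exact LinearMap.congr_fun (strCoeff_id E m.1) (x.2 m)
  map_comp φ ψ := by
    ext i : 2
    refine LinearMap.ext fun x => Prod.ext (funext fun m => ?_) (funext fun m => ?_)
    · exact LinearMap.congr_fun (strCoeff_comp φ ψ m.1) (x.1 m)
    · exact LinearMap.congr_fun (strCoeff_comp φ ψ m.1) (x.2 m)

instance : (HPComplex k).PreservesZeroMorphisms where
  map_zero E F := by
    ext i : 2
    refine LinearMap.ext fun x => Prod.ext (funext fun m => ?_) (funext fun m => ?_)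
    · exact LinearMap.congr_fun (strCoeff_zero E F m.1) (x.1 m)
    · exact LinearMap.congr_fun (strCoeff_zero E F m.1) (x.2 m)

variable (k) in
/-- Periodic cyclic homology `HP_i` of cyclic vector spaces. -/
noncomputable def HP (i : ℤ) : (Cyc ⥤ ModuleCat.{u} k) ⥤ ModuleCat.{u} k :=
  HPComplex k ⋙ HomologicalComplex.homologyFunctor _ _ i

end HP

end CyclicHomology

open CyclicHomology

/-!
The section `s` is the inverse of `HP_i(\overline{A_#}) → HP_i(A)` followed by
`HP_i(\overline{A_#}) → HP_i(\widehat{A_#})`; this is the only possible choice once the first map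
is an isomorphism, it is a section because the triangle of projections to `A_#` commutes, and a
section of `HP_i(\widehat{A_#}) → HP_i(A)` in every degree kills all connecting homomorphisms.

The map `HP_i(\overline{A_#}) → HP_i(A)` is an isomorphism (`isIso_HP_map_barProj`) by the long
exact sequence of `0 → j_! M^Δ_# → \overline{A_#} → A_# → 0` and the vanishing of periodic cyclic
homology on every cyclic vector space of the form `j_! E` (`HPComplex_jShriek_exactAt`). Strings of
morphisms of `Λ` with coefficients in `j_! E` are strings of morphisms between circles with a
distinguished marked point. On such circles the `2`-cocycle `wind` is the coboundary of the number
of turns at the distinguished point (`wind_eq_turns`), and cap product with this `1`-cochain is a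
null-homotopy of the periodicity map `u` (`cap_eq_homotopy`). Then `1 - u` is a homotopy equivalence
and the derived inverse limit, which is its fibre, is acyclic (`HPComplex_exactAt`).

The two rows are treated by linear algebra. Over a field the square-zero extension splits linearly,
which gives the exactness of the row of `\overline{A_#}` (`SquareZeroExtension.barRow_shortExact`);
the row of `\widehat{A_#}` is its pushout along `τ_#` (`hatRow_shortExact`). Direct sums and products
of vector spaces are exact, hence so is the passage to the complexes computing periodic cyclic
homology (`HPComplex_map_shortExact`).
-/

namespace CyclicHomology

open Limits

/-! ### Exactness of the rows -/

section Functors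

variable {J C : Type*} [Category* J] [Category* C] [Abelian C]

/-- Short exactness in a functor category may be tested on objects. -/
theorem shortExact_of_evaluation (T : ShortComplex (J ⥤ C))
    (h : ∀ X, (T.map ((evaluation J C).obj X)).ShortExact) : T.ShortExact where
  mono_f := by
    have (X : J) : Mono (T.f.app X) := (h X).mono_f
    exact NatTrans.mono_of_mono_app _
  epi_g := by
    have (X : J) : Epi (T.g.app X) := (h X).epi_g
    exact NatTrans.epi_of_epi_app _
  exact := by
    rw [ShortComplex.exact_iff_isZero_homology, IsZero.iff_id_eq_zero]
    ext X
    exact (IsZero.of_iso ((ShortComplex.exact_iff_isZero_homology _).1 (h X).exact)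
      (T.mapHomologyIso ((evaluation J C).obj X)).symm).eq_of_src _ _

/-- A pushout of a short exact sequence along a map out of its left-hand term is short exact. -/
theorem shortExact_pushout {T : ShortComplex C} (hT : T.ShortExact) {Y : C} (τ : T.X₁ ⟶ Y) :
    (ShortComplex.mk (pushout.inl τ T.f)
      (pushout.desc 0 T.g (by rw [comp_zero, T.zero])) (pushout.inl_desc _ _ _)).ShortExact := by
  have := hT.mono_f
  have := hT.epi_g
  have hepi : Epi (pushout.desc (f := τ) (g := T.f) 0 T.g (by rw [comp_zero, T.zero])) :=
    epi_of_epi_fac (pushout.inr_desc (f := τ) (g := T.f) 0 T.g (by rw [comp_zero, T.zero]))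
  refine { mono_f := inferInstance, epi_g := hepi, exact := ?_ }
  refine ShortComplex.exact_of_g_is_cokernel _ (CokernelCofork.IsColimit.ofπ' _ _ fun φ hφ => ?_)
  have hz : T.f ≫ pushout.inr τ T.f ≫ φ = 0 := by
    rw [← Category.assoc, ← pushout.condition, Category.assoc, hφ, comp_zero]
  refine ⟨hT.exact.desc _ hz, pushout.hom_ext ?_ ?_⟩
  · rw [pushout.inl_desc_assoc, zero_comp, hφ]
  · rw [pushout.inr_desc_assoc, hT.exact.g_desc]

end Functors

section Rows

variable {k A M E : Type u} [Field k] [Ring A] [Algebra k A]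
  [AddCommGroup M] [Module k M] [Module A M] [Module Aᵐᵒᵖ M]
  [SMulCommClass A Aᵐᵒᵖ M] [IsScalarTower k A M] [IsScalarTower k Aᵐᵒᵖ M]
  [Ring E] [Algebra k E]

namespace SquareZeroExtension

variable (S : SquareZeroExtension k A M E)

/-- The sequence `0 → j_! M^Δ_# → \overline{A_#} → A_# → 0`. -/
noncomputable def barRow : ShortComplex (Cyc ⥤ ModuleCat.{u} k) :=
  ShortComplex.mk S.barIncl S.barProj S.barIncl_barProj

theorem barIncl_lof {X : Cyc} {v : ZMod X.n} {c : ZMod X.n → TrivSqZeroExt A M} {e : ZMod X.n → E}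
    (h : S.IsLiftOf v c e) :
    (S.barIncl.app X).hom (DirectSum.lof k (ZMod X.n) (fun w => (mDelta k A M).obj ⟨X, w⟩) v
      (mixedProj k ⟨X, v⟩ (PiTensorProduct.tprod k c))) = S.cls e :=
  (jDesc_lof S.deltaIncl X v _).trans (S.deltaInclAux_mixedProj ⟨X, v⟩ h)

theorem p_update_self {n : ℕ} {v : ZMod n} (b : ZMod n → E) (x : E) :
    (fun u : {u : ZMod n // u ≠ v} => S.p (Function.update b v x u.1)) = fun u => S.p (b u.1) := by
  funext u
  rw [Function.update_of_ne u.2]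

theorem p_update_of_ne {n : ℕ} {v w : ZMod n} (hw : w ≠ v) (b : ZMod n → E) (x : E) :
    (fun u : {u : ZMod n // u ≠ v} => S.p (Function.update b w x u.1)) =
      Function.update (fun u : {u : ZMod n // u ≠ v} => S.p (b u.1)) ⟨w, hw⟩ (S.p x) := by
  funext u
  by_cases hu : u = ⟨w, hw⟩
  · subst hu; simp
  · rw [Function.update_of_ne hu, Function.update_of_ne (fun h => hu (Subtype.ext h))]

/-- The map `Ã ^ {⊗ V([n])} → M ⊗ A ^ {⊗ (V([n]) ∖ {v})}` given by a linear map `r : Ã → M` at the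
place `v` and by the projection `Ã → A` at the other places. -/
noncomputable def retractAt (r : E →ₗ[k] M) (P : PtCyc) : Tens k E P.base →ₗ[k] MTens k M A P :=
  PiTensorProduct.lift (MultilinearMap.mk'
    (fun b => r (b P.v) ⊗ₜ[k] PiTensorProduct.tprod k
      (fun w : {w : ZMod P.base.n // w ≠ P.v} => S.p (b w.1)))
    (fun b w x y => by
      by_cases hw : w = P.v
      · subst hw
        simp only [Function.update_self, map_add, TensorProduct.add_tmul, S.p_update_self]
      · simp only [Function.update_of_ne (Ne.symm hw), S.p_update_of_ne hw, map_add,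
          MultilinearMap.map_update_add, TensorProduct.tmul_add])
    (fun b w c x => by
      by_cases hw : w = P.v
      · subst hw
        simp only [Function.update_self, map_smul, TensorProduct.smul_tmul', S.p_update_self]
      · simp only [Function.update_of_ne (Ne.symm hw), S.p_update_of_ne hw, map_smul,
          MultilinearMap.map_update_smul, TensorProduct.tmul_smul]))

theorem retractAt_tprod (r : E →ₗ[k] M) (P : PtCyc) (b : ZMod P.base.n → E) :
    S.retractAt r P (PiTensorProduct.tprod k b) = r (b P.v) ⊗ₜ[k] PiTensorProduct.tprod k
      (fun w : {w : ZMod P.base.n // w ≠ P.v} => S.p (b w.1)) := by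
  simp [retractAt, MultilinearMap.mk']

theorem retractAt_tprod_eq_zero (r : E →ₗ[k] M) (P : PtCyc) (b : ZMod P.base.n → E)
    {w : ZMod P.base.n} (hw : w ≠ P.v) (hb : S.p (b w) = 0) :
    S.retractAt r P (PiTensorProduct.tprod k b) = 0 := by
  rw [retractAt_tprod, (PiTensorProduct.tprod k).map_coord_zero ⟨w, hw⟩ hb, TensorProduct.tmul_zero]

theorem filt_two_le_ker_retractAt (r : E →ₗ[k] M) (P : PtCyc) :
    S.filt 2 P.base ≤ LinearMap.ker (S.retractAt r P) := by
  refine Submodule.span_le.2 ?_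
  rintro _ ⟨b, T, hT, hb, rfl⟩
  obtain ⟨w, hw, hwv⟩ := Finset.exists_mem_ne hT P.v
  exact S.retractAt_tprod_eq_zero r P b hwv (hb w hw)

/-- A linear retraction of `M → Ã`, applied at the place `v`, recovers the summand at `v` and
vanishes on the others, where the factor at some place `w ≠ v` lies in the kernel of `Ã → A`. -/
theorem barIncl_injective (X : Cyc) : Function.Injective (S.barIncl.app X).hom := by
  obtain ⟨r, hr⟩ := S.i.exists_leftInverse_of_injective (LinearMap.ker_eq_bot.2 S.injective)
  let ρ (v : ZMod X.n) : (Tens k E X ⧸ S.filt 2 X) →ₗ[k] MTens k M A ⟨X, v⟩ :=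
    Submodule.liftQ _ (S.retractAt r ⟨X, v⟩) (S.filt_two_le_ker_retractAt r ⟨X, v⟩)
  have key (v : ZMod X.n) : ρ v ∘ₗ (S.barIncl.app X).hom =
      DirectSum.component k (ZMod X.n) (fun w => MTens k M A ⟨X, w⟩) v := by
    refine DirectSum.linearMap_ext k fun w => MTens.ext k fun c hc => ?_
    have hl := S.isLiftOf_liftFam (v := w) c
    refine (congrArg (ρ v) (S.barIncl_lof hl)).trans ?_
    refine Eq.trans (b := S.retractAt r ⟨X, v⟩ (PiTensorProduct.tprod k _)) rfl ?_
    by_cases h : w = v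
    · subst h
      refine Eq.trans ?_ (DirectSum.component.lof_self k
        (M := fun w => MTens k M A ⟨X, w⟩) w _).symm
      rw [retractAt_tprod, mixedProj_tprod]
      congr 1
      · exact (congrArg r hl.1).trans (LinearMap.congr_fun hr _)
      · congr 1
        funext u
        exact hl.2 u.1 u.2
    · rw [S.retractAt_tprod_eq_zero r ⟨X, v⟩ _ (w := w) h (by rw [hl.1, p_i])]
      exact (DirectSum.component.of k (M := fun w => MTens k M A ⟨X, w⟩) v w _).trans
        (dif_neg h) |>.symm
  refine fun x y hxy => DFinsupp.ext fun v => ?_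
  have h := congrArg (ρ v) hxy
  exact (LinearMap.congr_fun (key v) x).symm.trans (h.trans (LinearMap.congr_fun (key v) y))

theorem cls_mem_range_barIncl {X : Cyc} (e : ZMod X.n → E) {v : ZMod X.n} (h : S.p (e v) = 0) :
    S.cls e ∈ LinearMap.range (S.barIncl.app X).hom := by
  obtain ⟨m, hm⟩ := (S.exact _).1 h
  let c : ZMod X.n → TrivSqZeroExt A M :=
    fun w => TrivSqZeroExt.inl (S.p (e w)) + TrivSqZeroExt.inr m
  exact ⟨_, S.barIncl_lof (v := v) (c := c) ⟨by simp [c, hm], fun w _ => by simp [c]⟩⟩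

/-- The class of a pure tensor is determined by its image in `A_#` up to `j_! M^Δ_#`. -/
theorem cls_sub_cls_mem_range {X : Cyc} (b c : ZMod X.n → E) (h : ∀ w, S.p (b w) = S.p (c w)) :
    S.cls c - S.cls b ∈ LinearMap.range (S.barIncl.app X).hom := by
  have key : ∀ T : Finset (ZMod X.n), S.cls (T.piecewise c b) - S.cls b ∈
      LinearMap.range (S.barIncl.app X).hom := by
    intro T
    induction T using Finset.induction with
    | empty => simp
    | insert w T hw ih =>
      have h1 : c w = b w + (c w - b w) := by abel
      have h2 : Function.update (T.piecewise c b) w (b w) = T.piecewise c b := by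
        rw [Function.update_eq_self_iff, Finset.piecewise_eq_of_notMem _ _ _ hw]
      rw [Finset.piecewise_insert, h1, cls_update_add, h2, add_sub_right_comm]
      exact add_mem ih (S.cls_mem_range_barIncl _ (v := w) (by simp [h w]))
  simpa using key Finset.univ

theorem exact_barIncl_barProj (X : Cyc) :
    Function.Exact (S.barIncl.app X).hom (S.barProj.app X).hom := by
  obtain ⟨s, hs⟩ := S.p.toLinearMap.exists_rightInverse_of_surjective
    (LinearMap.range_eq_top.2 S.surjective)
  have hs' (a : A) : S.p (s a) = a := LinearMap.congr_fun hs a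
  let σ : Tens k A X →ₗ[k] (Tens k E X ⧸ S.filt 2 X) :=
    (S.filt 2 X).mkQ ∘ₗ PiTensorProduct.map fun _ => s
  let R := LinearMap.range (S.barIncl.app X).hom
  have key : R.mkQ ∘ₗ (S.filt 2 X).mkQ = R.mkQ ∘ₗ σ ∘ₗ tensAlg S.p X := by
    refine PiTensorProduct.ext (MultilinearMap.ext fun b => ?_)
    refine (Submodule.Quotient.eq R).2 ?_
    have : σ (tensAlg S.p X (PiTensorProduct.tprod k b)) = S.cls fun v => s (S.p (b v)) := by
      rw [tensAlg_tprod]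
      exact congrArg (S.filt 2 X).mkQ (PiTensorProduct.map_tprod _ _)
    refine Eq.mp (congrArg (fun z => S.cls b - z ∈ R) this.symm) ?_
    exact S.cls_sub_cls_mem_range _ _ fun w => hs' _
  intro y
  constructor
  · intro hy
    obtain ⟨x, rfl⟩ := (S.filt 2 X).mkQ_surjective y
    have hx : tensAlg S.p X x = 0 := hy
    refine (Submodule.Quotient.mk_eq_zero R).1 ((LinearMap.congr_fun key x).trans ?_)
    change R.mkQ (σ (tensAlg S.p X x)) = 0
    rw [hx, map_zero]
    exact map_zero R.mkQ
  · rintro ⟨x, rfl⟩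
    exact congrArg (fun φ => (φ.app X).hom x) S.barIncl_barProj

theorem barProj_surjective (X : Cyc) : Function.Surjective (S.barProj.app X).hom := by
  intro y
  obtain ⟨s, hs⟩ := S.p.toLinearMap.exists_rightInverse_of_surjective
    (LinearMap.range_eq_top.2 S.surjective)
  refine ⟨(S.filt 2 X).mkQ (PiTensorProduct.map (fun _ => s) y), ?_⟩
  change (tensAlg S.p X ∘ₗ PiTensorProduct.map fun _ => s) y = y
  rw [tensAlg, ← PiTensorProduct.map_comp, hs, PiTensorProduct.map_id]
  rfl

theorem barRow_shortExact : S.barRow.ShortExact :=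
  shortExact_of_evaluation _ fun X => ModuleCat.shortComplex_shortExact _
    (S.exact_barIncl_barProj X) (S.barIncl_injective X) (S.barProj_surjective X)

end SquareZeroExtension

theorem hatRow_shortExact (S : SquareZeroExtension k A M E) (C : CyclicBimodule k A M) :
    (hatRow S C).ShortExact :=
  shortExact_pushout S.barRow_shortExact C.tau

end Rows

/-! ### Exactness of the periodic complex in the coefficients -/

section HPExact

theorem strCoeff_eq_lmap {Γ : Type} [Category.{0} Γ] {k : Type u} [Field k]
    {E F : Γ ⥤ ModuleCat.{u} k} (φ : E ⟶ F) (m : ℕ) :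
    strCoeff φ m =
      DirectSum.lmap fun σ : ComposableArrows Γ m => (φ.app (σ.obj 0)).hom := by
  classical
  refine str_ext E fun σ x => ?_
  rw [strCoeff_strIn]
  exact (DirectSum.lmap_lof (fun σ : ComposableArrows Γ m => (φ.app (σ.obj 0)).hom) σ x).symm

variable {k : Type u} [Field k]

theorem exact_strCoeff {T : ShortComplex (Cyc ⥤ ModuleCat.{u} k)}
    (h : ∀ X, Function.Exact (T.f.app X).hom (T.g.app X).hom) (m : ℕ) :
    Function.Exact (strCoeff T.f m) (strCoeff T.g m) := by
  rw [strCoeff_eq_lmap, strCoeff_eq_lmap, LinearMap.exact_iff, DirectSum.ker_lmap,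
    DirectSum.range_lmap]
  congr 2
  funext σ
  exact LinearMap.exact_iff.1 (h _)

theorem exact_towerMap {T : ShortComplex (Cyc ⥤ ModuleCat.{u} k)}
    (h : ∀ X, Function.Exact (T.f.app X).hom (T.g.app X).hom) (i : ℤ) :
    Function.Exact (towerMap T.f i) (towerMap T.g i) := by
  refine fun y => ⟨fun hy => ?_, ?_⟩
  · choose x hx using fun m : TowerIdx i => (exact_strCoeff h m.1 (y m)).1 (congrFun hy m)
    exact ⟨x, funext hx⟩
  · rintro ⟨x, rfl⟩
    exact funext fun m => (exact_strCoeff h m.1).apply_apply_eq_zero (x m)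

theorem towerMap_injective {E F : Cyc ⥤ ModuleCat.{u} k} (φ : E ⟶ F)
    (h : ∀ X, Function.Injective (φ.app X).hom) (i : ℤ) : Function.Injective (towerMap φ i) := by
  refine fun x y hxy => funext fun m => ?_
  have hm : Function.Injective (strCoeff φ m.1) := by
    rw [strCoeff_eq_lmap]
    exact (DirectSum.lmap_injective _).2 fun σ => h _
  exact hm (congrFun hxy m)

theorem towerMap_surjective {E F : Cyc ⥤ ModuleCat.{u} k} (φ : E ⟶ F)
    (h : ∀ X, Function.Surjective (φ.app X).hom) (i : ℤ) :
    Function.Surjective (towerMap φ i) := by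
  intro y
  have hm (m : ℕ) : Function.Surjective (strCoeff φ m) := by
    rw [strCoeff_eq_lmap]
    exact (DirectSum.lmap_surjective _).2 fun σ => h _
  choose x hx using fun m : TowerIdx i => hm m.1 (y m)
  exact ⟨x, funext hx⟩

/-- The periodic complex is an exact functor: it is built degreewise from direct sums and products
of the values of the coefficients. -/
theorem HPComplex_map_shortExact {T : ShortComplex (Cyc ⥤ ModuleCat.{u} k)} (hT : T.ShortExact) :
    (T.map (HPComplex k)).ShortExact := by
  have := hT.mono_f
  have := hT.epi_g
  have hX (X : Cyc) := hT.map_of_exact ((evaluation Cyc (ModuleCat.{u} k)).obj X)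
  have he (X : Cyc) : Function.Exact (T.f.app X).hom (T.g.app X).hom :=
    (ShortComplex.ShortExact.moduleCat_exact_iff_function_exact _).1 (hX X).exact
  have hi (X : Cyc) : Function.Injective (T.f.app X).hom := (hX X).moduleCat_injective_f
  have hs (X : Cyc) : Function.Surjective (T.g.app X).hom := (hX X).moduleCat_surjective_g
  refine HomologicalComplex.shortExact_of_degreewise_shortExact _ fun i =>
    ModuleCat.shortComplex_shortExact _ (fun y => ⟨fun hy => ?_, ?_⟩)
      ((towerMap_injective T.f hi i).prodMap (towerMap_injective T.f hi (i + 1)))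
      ((towerMap_surjective T.g hs i).prodMap (towerMap_surjective T.g hs (i + 1)))
  · obtain ⟨a, ha⟩ := (exact_towerMap he i y.1).1 (congrArg Prod.fst hy)
    obtain ⟨b, hb⟩ := (exact_towerMap he (i + 1) y.2).1 (congrArg Prod.snd hy)
    exact ⟨(a, b), Prod.ext ha hb⟩
  · rintro ⟨x, rfl⟩
    exact Prod.ext ((exact_towerMap he i).apply_apply_eq_zero x.1)
      ((exact_towerMap he (i + 1)).apply_apply_eq_zero x.2)

end HPExact

/-! ### Vanishing for null-homotopic periodicity -/

section Contractible

variable {k : Type u} [Field k] {E : Cyc ⥤ ModuleCat.{u} k}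

/-- If the periodicity map is null-homotopic on the product of the tower, then `1 - u` is a homotopy
equivalence, so that the complex of its fibre is acyclic. -/
theorem HPComplex_exactAt (H : ∀ i : ℤ, Tower E i →ₗ[k] Tower E (i + 1))
    (hH : ∀ (i : ℤ) (x : Tower E (i + 1)),
      towerU E (i + 1) x = towerD E (i + 1) (H (i + 1) x) + H i (towerD E i x)) (i : ℤ) :
    ((HPComplex k).obj E).ExactAt i := by
  obtain ⟨i, rfl⟩ : ∃ j, i = j + 1 := ⟨i - 1, by ring⟩
  rw [HomologicalComplex.exactAt_iff' _ (i + 1 + 1) (i + 1) i (by simp) (by simp),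
    ShortComplex.moduleCat_exact_iff]
  have hd (j : ℤ) : ((HPComplex k).obj E).d (j + 1) j = ModuleCat.ofHom (hpD E j) :=
    ChainComplex.of_d (fun i => ModuleCat.of k (Tower E i × Tower E (i + 1)))
      (fun i => ModuleCat.ofHom (hpD E i)) j
  rintro ⟨x, y⟩ hxy
  replace hxy : hpD E i (x, y) = 0 :=
    (congrArg (fun φ => φ.hom (x, y)) (hd i)).symm.trans hxy
  have hx : towerD E i x = 0 := congrArg Prod.fst hxy
  have hy : x - towerU E (i + 1) x - towerD E (i + 1) y = 0 := congrArg Prod.snd hxy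
  have hu : towerU E (i + 1) x = towerD E (i + 1) (H (i + 1) x) := by
    rw [hH, hx, map_zero, add_zero]
  -- The cycle condition reads `x = d a`.
  let a : Tower E (i + 1 + 1) := H (i + 1) x + y
  have ha : towerD E (i + 1) a = x := by
    rw [map_add, ← hu]
    rw [sub_sub, sub_eq_zero] at hy
    exact hy.symm
  refine ⟨(a, -H (i + 1 + 1) a), ?_⟩
  refine (congrArg (fun φ => φ.hom (a, -H (i + 1 + 1) a)) (hd (i + 1))).trans ?_
  refine Prod.ext ha ?_
  change a - towerU E (i + 1 + 1) a - towerD E (i + 1 + 1) (-H (i + 1 + 1) a) = y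
  rw [hH (i + 1) a, ha, map_neg]
  simp only [a]
  abel

end Contractible

/-! ### The periodicity map on induced cyclic vector spaces -/

section Induced

variable {k : Type u} [Field k]

/-- Relative to the lifts `v.val` of the marked points, the number of turns made by the normalized
lift of `f` at the point `v`. -/
noncomputable def turns {X Y : Cyc} (f : X ⟶ Y) (v : ZMod X.n) : ℤ := Cyc.lift f v.val / Y.n

theorem lift_val {X Y : Cyc} (f : X ⟶ Y) (v : ZMod X.n) :
    Cyc.lift f v.val = (Cyc.pt f v).val + turns f v * Y.n := by
  rw [turns, Cyc.pt, ZMod.val_intCast]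
  have := Int.emod_add_mul_ediv (Cyc.lift f (v.val : ℤ)) Y.n
  linarith

/-- The cocycle `wind` is a coboundary on the category of circles with a distinguished point. -/
theorem wind_eq_turns {X Y Z : Cyc} (f : X ⟶ Y) (g : Y ⟶ Z) (v : ZMod X.n) :
    wind f g = turns g (Cyc.pt f v) - turns (f ≫ g) v + turns f v := by
  have hZ : (Z.n : ℤ) ≠ 0 := by exact_mod_cast Z.pos.ne'
  have h : Cyc.lift g (Cyc.lift f v.val) = Cyc.lift (f ≫ g) v.val + wind f g * Z.n :=
    congrFun (congrArg CycLift.toFun (lift_comp_turn f g)) v.val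
  rw [lift_val, CycLift.per_mul, lift_val, lift_val, Cyc.pt_comp] at h
  refine mul_right_cancel₀ hZ ?_
  linarith

open Simplicial

/-- The number of turns of the morphism `σ a → σ b` of a string at the image of the point `v`
of `σ 0`. -/
noncomputable def turnsAt {n : ℕ} (σ : ComposableArrows Cyc n) (a b : Fin (n + 1)) (hab : a ≤ b)
    (v : ZMod (σ.obj 0).n) : ℤ :=
  turns (σ.map (homOfLE hab)) (Cyc.pt (σ.map (homOfLE (Fin.zero_le a))) v)

theorem windAt_eq_turnsAt {n : ℕ} (σ : ComposableArrows Cyc n) (a b c : Fin (n + 1)) (hab : a ≤ b)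
    (hbc : b ≤ c) (v : ZMod (σ.obj 0).n) :
    windAt σ a b c hab hbc =
      turnsAt σ b c hbc v - turnsAt σ a c (hab.trans hbc) v + turnsAt σ a b hab v := by
  have h := wind_eq_turns (σ.map (homOfLE hab)) (σ.map (homOfLE hbc))
    (Cyc.pt (σ.map (homOfLE (Fin.zero_le a))) v)
  rw [← Cyc.pt_comp, ← σ.map_comp, ← σ.map_comp] at h
  exact h

theorem turnsAt_pull {m n : ℕ} (α : ⦋m⦌ ⟶ ⦋n⦌) (σ : ComposableArrows Cyc n) (a b : Fin (m + 1))
    (hab : a ≤ b) (a' b' : Fin (n + 1)) (hab' : a' ≤ b') (ha : α.toOrderHom a = a')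
    (hb : α.toOrderHom b = b') (v : ZMod (σ.obj 0).n) :
    turnsAt (strPull α σ) a b hab
      (Cyc.pt (σ.map (homOfLE (Fin.zero_le (α.toOrderHom (0 : Fin (m + 1)))))) v) =
        turnsAt σ a' b' hab' v := by
  subst ha hb
  refine congrArg (turns (σ.map (homOfLE hab'))) ?_
  refine (Cyc.pt_comp _ _ v).symm.trans ?_
  exact congrArg (fun f => Cyc.pt f v) (σ.map_comp _ _).symm

variable (E : PtCyc ⥤ ModuleCat.{u} k)

/-- The inclusion `E(⟨[n], v⟩) → (j_! E)([n])`. -/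
noncomputable def jIn (X : Cyc) (v : ZMod X.n) : E.obj ⟨X, v⟩ →ₗ[k] (jShriek E).obj X :=
  DirectSum.lof k (ZMod X.n) (fun w => E.obj ⟨X, w⟩) v

variable {E} in
/-- The map out of `(j_! E)([n])` with given restrictions to the summands. -/
noncomputable def jOut {X : Cyc} {V : Type u} [AddCommGroup V] [Module k V]
    (φ : ∀ v : ZMod X.n, E.obj ⟨X, v⟩ →ₗ[k] V) : (jShriek E).obj X →ₗ[k] V :=
  DirectSum.toModule k (ZMod X.n) V φ

theorem jOut_jIn {X : Cyc} {V : Type u} [AddCommGroup V] [Module k V]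
    (φ : ∀ v : ZMod X.n, E.obj ⟨X, v⟩ →ₗ[k] V) (v : ZMod X.n) (x : E.obj ⟨X, v⟩) :
    jOut φ (jIn E X v x) = φ v x :=
  DirectSum.toModule_lof (φ := φ) k v x

theorem jIn_ext {X : Cyc} {V : Type u} [AddCommGroup V] [Module k V]
    {φ ψ : (jShriek E).obj X →ₗ[k] V} (h : ∀ v x, φ (jIn E X v x) = ψ (jIn E X v x)) : φ = ψ :=
  DirectSum.linearMap_ext k fun v => LinearMap.ext fun x => h v x

theorem jShriek_map_jIn {X Y : Cyc} (f : X ⟶ Y) (v : ZMod X.n) (x : E.obj ⟨X, v⟩) :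
    ((jShriek E).map f).hom (jIn E X v x) = jIn E Y (Cyc.pt f v)
      ((E.map (PtCyc.homMk f rfl : (⟨X, v⟩ : PtCyc) ⟶ ⟨Y, Cyc.pt f v⟩)).hom x) :=
  jOut_jIn E (V := (jShriek E).obj Y) (fun v => jIn E Y (Cyc.pt f v) ∘ₗ
    (E.map (PtCyc.homMk f rfl : (⟨X, v⟩ : PtCyc) ⟶ ⟨Y, Cyc.pt f v⟩)).hom) v x

/-- The inclusion into the strings with coefficients in `j_! E` of the summand of a string `σ`
and of a marked point of `σ 0`. These pairs are the strings in the category of pointed circles. -/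
noncomputable def ptIn {m : ℕ} (σ : ComposableArrows Cyc m) (v : ZMod (σ.obj 0).n) :
    E.obj ⟨σ.obj 0, v⟩ →ₗ[k] Str (jShriek E) m :=
  strIn (jShriek E) σ ∘ₗ jIn E (σ.obj 0) v

theorem ptIn_ext {m : ℕ} {V : Type u} [AddCommGroup V] [Module k V]
    {φ ψ : Str (jShriek E) m →ₗ[k] V}
    (h : ∀ (σ : ComposableArrows Cyc m) (v : ZMod (σ.obj 0).n) (x : E.obj ⟨σ.obj 0, v⟩),
      φ (ptIn E σ v x) = ψ (ptIn E σ v x)) : φ = ψ :=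
  str_ext _ fun σ x => LinearMap.congr_fun
    (jIn_ext E (φ := φ ∘ₗ strIn (jShriek E) σ) (ψ := ψ ∘ₗ strIn (jShriek E) σ) (h σ)) x

theorem strMap_ptIn {m n : SimplexCategory} (α : m ⟶ n) (σ : ComposableArrows Cyc n.len)
    (v : ZMod (σ.obj 0).n) (x : E.obj ⟨σ.obj 0, v⟩) :
    ∃ y, strMap (jShriek E) α (ptIn E σ v x) = ptIn E (strPull α σ)
      (Cyc.pt (σ.map (homOfLE (Fin.zero_le (α.toOrderHom 0)))) v) y :=
  ⟨_, (strMap_strIn _ α σ _).trans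
    (congrArg (strIn (jShriek E) (strPull α σ)) (jShriek_map_jIn E _ v x))⟩

/-- Multiplication of the summands of strings of pointed circles by a function. -/
noncomputable def ptWeight {m : ℕ}
    (c : ∀ σ : ComposableArrows Cyc m, ZMod (σ.obj 0).n → k) :
    Str (jShriek E) m →ₗ[k] Str (jShriek E) m :=
  strDesc (jShriek E) fun σ => jOut fun v => c σ v • ptIn E σ v

theorem ptWeight_ptIn {m : ℕ} (c : ∀ σ : ComposableArrows Cyc m, ZMod (σ.obj 0).n → k)
    (σ : ComposableArrows Cyc m) (v : ZMod (σ.obj 0).n) (x : E.obj ⟨σ.obj 0, v⟩) :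
    ptWeight E c (ptIn E σ v x) = c σ v • ptIn E σ v x :=
  (strDesc_strIn (jShriek E) _ σ _).trans (jOut_jIn E (fun v => c σ v • ptIn E σ v) v x)

/-- The number of turns of the last morphism of a string. -/
noncomputable def lastTurns (k : Type u) [Field k] (m : ℕ) (σ : ComposableArrows Cyc (m + 1))
    (v : ZMod (σ.obj 0).n) : k :=
  (turnsAt σ (Fin.last m).castSucc (Fin.last (m + 1)) (Fin.le_last _) v : ℤ)

/-- The chain level null-homotopy of the periodicity map on `j_! E`: cap product with the cochain
`turns` which bounds the cocycle `wind`. -/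
noncomputable def capHomotopy (m : ℕ) : Str (jShriek E) (m + 1) →ₗ[k] Str (jShriek E) m :=
  (-1 : ℤ) ^ m • strMap (jShriek E) (SimplexCategory.δ (Fin.last (m + 1))) ∘ₗ
    ptWeight E (lastTurns k m)

theorem capHomotopy_ptIn (m : ℕ) (σ : ComposableArrows Cyc (m + 1)) (v : ZMod (σ.obj 0).n)
    (x : E.obj ⟨σ.obj 0, v⟩) :
    capHomotopy E m (ptIn E σ v x) = (-1 : ℤ) ^ m • lastTurns k m σ v •
      strMap (jShriek E) (SimplexCategory.δ (Fin.last (m + 1))) (ptIn E σ v x) := by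
  rw [capHomotopy, LinearMap.smul_apply, LinearMap.comp_apply, ptWeight_ptIn, map_smul]

/-- In `d h - h d` the faces which keep the last morphism cancel, and the others add up to the
coboundary of `turns`; the sign `(-1) ^ m` in `capHomotopy` turns this difference into a sum. -/
theorem cap_eq_homotopy (m : ℕ) :
    cap (jShriek E) m = strD (jShriek E) m ∘ₗ capHomotopy E (m + 1) +
      capHomotopy E m ∘ₗ strD (jShriek E) (m + 1) := by
  refine ptIn_ext E fun σ v x => ?_
  have key : ∀ i : Fin (m + 3), ∀ c : k,
      lastTurns k m (strPull (SimplexCategory.δ i) σ)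
        (Cyc.pt (σ.map (homOfLE (Fin.zero_le ((SimplexCategory.δ i).toOrderHom 0)))) v) = c →
      capHomotopy E m (strMap (jShriek E) (SimplexCategory.δ i) (ptIn E σ v x)) =
      (-1 : ℤ) ^ m • c • strMap (jShriek E) (SimplexCategory.δ (Fin.last (m + 1)) ≫
        SimplexCategory.δ i) (ptIn E σ v x) := by
    rintro i _ rfl
    rw [strMap_comp, LinearMap.comp_apply]
    obtain ⟨y, hy⟩ := strMap_ptIn E (SimplexCategory.δ i) σ v x
    rw [hy]
    exact capHomotopy_ptIn E m (strPull (SimplexCategory.δ i) σ) _ y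
  -- The faces `δ i` with `i ≤ m` do not affect the last morphism.
  have c0 (i : Fin (m + 1)) := key i.castSucc.castSucc (lastTurns k (m + 1) σ v) <|
    congrArg (Int.cast (R := k)) <|
    turnsAt_pull _ σ _ _ _ _ _ (Fin.le_last _)
      (Fin.ext ((δ_val _ _).trans (if_neg (by simp; omega))))
      (Fin.ext ((δ_val _ _).trans (if_neg (by simp)))) v
  have c1 := key (Fin.last (m + 1)).castSucc _ <| congrArg (Int.cast (R := k)) <|
    turnsAt_pull _ σ _ _ _ ⟨m, by omega⟩ ⟨m + 2, by omega⟩ (by simp)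
      (Fin.ext ((δ_val _ _).trans (if_pos (by simp))))
      (Fin.ext ((δ_val _ _).trans (if_neg (by simp)))) v
  have c2 := key (Fin.last (m + 2)) _ <| congrArg (Int.cast (R := k)) <|
    turnsAt_pull _ σ _ _ _ ⟨m, by omega⟩ ⟨m + 1, by omega⟩ (by simp)
      (Fin.ext ((δ_val _ _).trans (if_pos (by simp))))
      (Fin.ext ((δ_val _ _).trans (if_pos (by simp)))) v
  have hδ (i : Fin (m + 1)) : SimplexCategory.δ (Fin.last (m + 1)) ≫
      SimplexCategory.δ i.castSucc.castSucc =
        SimplexCategory.δ i.castSucc ≫ SimplexCategory.δ (Fin.last (m + 2)) :=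
    (SimplexCategory.δ_comp_δ (Fin.le_last i.castSucc)).symm
  have hf (i : Fin (m + 3)) (hi : m < (i : ℕ)) :
      SimplexCategory.δ (Fin.last (m + 1)) ≫ SimplexCategory.δ i = front m :=
    hom_ext_val fun j => by
      refine (δ_val i _).trans ?_
      have h1 := δ_val (Fin.last (m + 1)) j
      rw [if_pos (by rw [Fin.val_last]; omega)] at h1
      rw [h1, if_pos (by omega)]
      rfl
  have hcap : cap (jShriek E) m (ptIn E σ v x) =
      capCoeff k m σ • strMap (jShriek E) (front m) (ptIn E σ v x) := cap_strIn _ m σ _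
  have hw := congrArg (Int.cast (R := k)) (windAt_eq_turnsAt σ ⟨m, by omega⟩ ⟨m + 1, by omega⟩
    ⟨m + 2, by omega⟩ (by simp) (by simp) v)
  push_cast at hw
  rw [hcap, LinearMap.add_apply, LinearMap.comp_apply, LinearMap.comp_apply, capHomotopy_ptIn,
    map_zsmul, map_smul, strD_eq, strD_eq]
  have hcomp (i : Fin (m + 2)) : strMap (jShriek E) (SimplexCategory.δ i)
      (strMap (jShriek E) (SimplexCategory.δ (Fin.last (m + 2))) (ptIn E σ v x)) =
        strMap (jShriek E) (SimplexCategory.δ i ≫ SimplexCategory.δ (Fin.last (m + 2)))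
          (ptIn E σ v x) := by
    rw [strMap_comp, LinearMap.comp_apply]
  simp only [LinearMap.sum_apply, LinearMap.smul_apply, map_sum, map_zsmul, hcomp]
  rw [Fin.sum_univ_castSucc, Fin.sum_univ_castSucc (n := m + 2), Fin.sum_univ_castSucc (n := m + 1),
    c1, c2, hf _ (by simp), hf _ (by simp)]
  simp only [c0, hδ]
  -- The terms of `front m` match by `wind = ∂ turns`; the two sums over `i ≤ m` cancel.
  have hc : capCoeff k m σ = lastTurns k (m + 1) σ v -
      (turnsAt σ ⟨m, by omega⟩ ⟨m + 2, by omega⟩ (by simp) v : ℤ) +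
      (turnsAt σ ⟨m, by omega⟩ ⟨m + 1, by omega⟩ (by simp) v : ℤ) := hw
  have hcomm (j : ℕ) (z : Str (jShriek E) m) : lastTurns k (m + 1) σ v • (-1 : ℤ) ^ j • z =
      (-1 : ℤ) ^ j • lastTurns k (m + 1) σ v • z := smul_comm _ _ _
  rw [hc, smul_add, smul_add, Finset.smul_sum, Finset.smul_sum]
  rcases neg_one_pow_eq_or ℤ m with h | h
  · simp only [Fin.val_castSucc, Fin.val_last, pow_succ, h, add_smul, sub_smul, hcomm, one_smul,
      mul_neg, mul_one, neg_neg, neg_smul, Finset.sum_neg_distrib, smul_neg]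
    abel
  · simp only [Fin.val_castSucc, Fin.val_last, pow_succ, h, add_smul, sub_smul, hcomm, one_smul,
      mul_neg, mul_one, neg_neg, neg_smul, Finset.sum_neg_distrib, smul_neg]
    abel

/-- The degree `m + 1`, of the form `i + 2 N`, for `m` of the form `i + 1 + 2 N`. -/
def TowerIdx.up {i : ℤ} (m : TowerIdx (i + 1)) : TowerIdx i :=
  ⟨m.1 + 1, by obtain ⟨N, hN⟩ := m.2; exact ⟨N + 1, by push_cast; linarith⟩⟩

/-- The null-homotopy `capHomotopy` on the product of the tower. -/
noncomputable def towerHomotopy (i : ℤ) : Tower (jShriek E) i →ₗ[k] Tower (jShriek E) (i + 1) :=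
  LinearMap.pi fun m => capHomotopy E m.1 ∘ₗ LinearMap.proj m.up

theorem HPComplex_jShriek_exactAt (i : ℤ) : ((HPComplex k).obj (jShriek E)).ExactAt i :=
  HPComplex_exactAt (towerHomotopy E)
    (fun _ x => funext fun m => LinearMap.congr_fun (cap_eq_homotopy E m.1) (x m.add2)) i

end Induced

end CyclicHomology

open CyclicHomology

/-! ### The splitting of the long exact sequence -/

/-- The natural map `HP_i(\overline{A_#}) → HP_i(A)` is an isomorphism. -/
theorem isIso_HP_map_barProj {k A M E : Type u} [Field k] [Ring A] [Algebra k A]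
    [AddCommGroup M] [Module k M] [Module A M] [Module Aᵐᵒᵖ M] [SMulCommClass A Aᵐᵒᵖ M]
    [IsScalarTower k A M] [IsScalarTower k Aᵐᵒᵖ M] [Ring E] [Algebra k E]
    (S : SquareZeroExtension k A M E) (i : ℤ) : IsIso ((HP k i).map S.barProj) := by
  have h := HPComplex_map_shortExact S.barRow_shortExact
  have hz (j : ℤ) : Limits.IsZero ((S.barRow.map (HPComplex k)).X₁.homology j) :=
    (HPComplex_jShriek_exactAt (mDelta k A M) j).isZero_homology
  have hm : Mono (HomologicalComplex.homologyMap (S.barRow.map (HPComplex k)).g i) :=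
    (h.homology_exact₂ i).mono_g ((hz i).eq_of_src _ _)
  have he : Epi (HomologicalComplex.homologyMap (S.barRow.map (HPComplex k)).g i) :=
    (h.homology_exact₃ i (i - 1) (by simp)).epi_f ((hz (i - 1)).eq_of_tgt _ _)
  exact isIso_of_mono_of_epi (HomologicalComplex.homologyMap (S.barRow.map (HPComplex k)).g i)

theorem proposition3 {k A M E : Type u} [Field k] [Ring A] [Algebra k A]
    [AddCommGroup M] [Module k M] [Module A M] [Module Aᵐᵒᵖ M] [SMulCommClass A Aᵐᵒᵖ M]
    [IsScalarTower k A M] [IsScalarTower k Aᵐᵒᵖ M] [Ring E] [Algebra k E]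
    (S : SquareZeroExtension k A M E) (C : CyclicBimodule k A M) :
    (hatRow S C).ShortExact ∧
      ∃ h : ((hatRow S C).map (HPComplex k)).ShortExact,
        (∀ (i j : ℤ) (hij : (ComplexShape.down ℤ).Rel i j), h.δ i j hij = 0) ∧
        ∀ i : ℤ, ∃ s : (HP k i).obj (sharp k A) ⟶ (HP k i).obj (hat S C),
          s ≫ (HP k i).map (hatRow S C).g = 𝟙 _ ∧
          (HP k i).map S.barProj ≫ s = (HP k i).map (barToHat S C) ∧
          ∀ s' : (HP k i).obj (sharp k A) ⟶ (HP k i).obj (hat S C),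
            (HP k i).map S.barProj ≫ s' = (HP k i).map (barToHat S C) → s' = s := by
  have hfac (i : ℤ) :
      (HP k i).map (barToHat S C) ≫ (HP k i).map (hatRow S C).g = (HP k i).map S.barProj := by
    refine ((HP k i).map_comp (barToHat S C) (hatRow S C).g).symm.trans ?_
    exact congrArg (HP k i).map (Limits.pushout.inr_desc _ _ _)
  have hiso (i : ℤ) := isIso_HP_map_barProj S i
  have hsec (i : ℤ) : (inv ((HP k i).map S.barProj) ≫ (HP k i).map (barToHat S C)) ≫
      (HP k i).map (hatRow S C).g = 𝟙 _ := by
    rw [Category.assoc, hfac]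
    exact IsIso.inv_hom_id _
  have h := HPComplex_map_shortExact (hatRow_shortExact S C)
  refine ⟨hatRow_shortExact S C, h, fun i j hij => ?_, fun i =>
    ⟨inv ((HP k i).map S.barProj) ≫ (HP k i).map (barToHat S C), hsec i, by simp,
      fun s' hs' => by rw [← hs', IsIso.inv_hom_id_assoc]⟩⟩
  -- The boundary map vanishes on the image of a split epimorphism.
  have hg : (HP k i).map (hatRow S C).g ≫ h.δ i j hij = 0 := h.comp_δ i j hij
  have : Epi ((HP k i).map (hatRow S C).g) := (SplitEpi.mk _ (hsec i)).epi
  exact (cancel_epi ((HP k i).map (hatRow S C).g)).1 (hg.trans Limits.comp_zero.symm)
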